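/- **Conventions.** Let $G$ be a connected Lie group with Lie algebra $\mathfrak g$, let $[\mathfrak g,\mathfrak g]$ be the linear span of all brackets, and let $n=\dim_{\mathbb R}\mathfrak g/[\mathfrak g,\mathfrak g]$. Given a linear isomorphism $\psi:\mathfrak g/[\mathfrak g,\mathfrak g]\to\mathbb R^n$, a *natural epimorphism* belonging to $\psi$ is a smooth surjective group homomorphism $\Phi:G\to(\mathbb R^n,+)$ whose differential at the identity is $d\Phi_e=\psi\circ\pi$, where $\pi:\mathfrak g\to\mathfrak g/[\mathfrak g,\mathfrak g]$ is the quotient map. Write $(z,w)=\sum_{i=1}^n z_iw_i$ for the standard symmetric complex bilinear form on $\mathbb C^n$; a complex subspace $V\subset\mathbb C^n$ is *isotropic* if $(v,w)=0$ for all $v,w\in V$, and *maximal isotropic* if it is maximal with respect to inclusion among isotropic subspaces. For a Riemannian metric $g$ on $G$ let $\tau$ be the Laplace–Beltrami operator, extended complex linearly to complex-valued functions, and put $\kappa(\phi,\psi)=g(\operatorname{grad}\phi,\operatorname{grad}\psi)$ for $\phi,\psi:G\to\mathbb C$, with $g$ extended complex bilinearly. A smooth map $\phi:G\to\mathbb C$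 is a *harmonic morphism* on $(G,g)$ if for every open $U\subset\mathbb C$ with $\phi^{-1}(U)\neq\emptyset$ and every harmonic function $f:U\to\mathbb R$ the function $f\circ\phi$ is harmonic on $\phi^{-1}(U)$. A set $\Omega$ of smooth functions $G\to\mathbb C$ is an *orthogonal harmonic family* on $(G,g)$ if $\tau(\phi)=0$ and $\kappa(\phi,\psi)=0$ for all $\phi,\psi\in\Omega$. **Theorem.** Let $G$ be a connected, simply connected, non-Abelian nilpotent Lie group, with $\mathfrak g$ and $n$ as above. Then $n\ge 2$, and for every linear isomorphism $\psi:\mathfrak g/[\mathfrak g,\mathfrak g]\to\mathbb R^n$ there is a natural epimorphism $\Phi:G\to\mathbb R^n$ belonging to $\psi$. Moreover, for every such $\Phi$: 1. there exists a left-invariant Riemannian metric $g$ on $G$ such that $\Phi:(G,g)\to\mathbb R^n$ is a Riemannian submersion onto the standard Euclidean space $\mathbb R^n$; 2. for every left-invariant Riemannian metric $g$ on $G$ such that $\Phi:(G,g)\to\mathbb R^n$ is a Riemannian submersion, and for every maximal isotropic subspace $V$ of $\mathbb C^n$, the set $$\Omega_V=\{\phi_v:G\to\mathbb C,\ \phi_v(x)=(\Phi(x),v)\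 |\ v\in V\}$$ is an orthogonal harmonic family on $(G,g)$, and each $\phi_v$, $v\in V$, is a harmonic morphism on $(G,g)$. -/

import Mathlib

open scoped Manifold ContDiff

noncomputable section

namespace HarmonicMorphisms

section Riemannian

variable {E : Type*} [NormedAddCommGroup E] [NormedSpace ℝ E]
  {M : Type*} [TopologicalSpace M] [ChartedSpace E M] [IsManifold 𝓘(ℝ, E) ∞ M]

/-- Smooth Riemannian metrics on the manifold `M`, which is modelled on the vector space `E`. -/
abbrev Metric (E : Type*) [NormedAddCommGroup E] [NormedSpace ℝ E]
    (M : Type*) [TopologicalSpace M] [ChartedSpace E M] [IsManifold 𝓘(ℝ, E) ∞ M] : Type _ :=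
  Bundle.ContMDiffRiemannianMetric 𝓘(ℝ, E) ∞ E (fun x : M ↦ TangentSpace 𝓘(ℝ, E) x)

/-- A smooth map `Φ` from a Riemannian manifold to a Euclidean space is a Riemannian submersion if
it is surjective, each differential is surjective, and each differential is isometric on the
horizontal space, the orthogonal complement of its kernel. -/
structure IsRiemannianSubmersion (g : Metric E M) {F : Type*} [NormedAddCommGroup F]
    [InnerProductSpace ℝ F] (Φ : M → F) : Prop where
  contMDiff : ContMDiff 𝓘(ℝ, E) 𝓘(ℝ, F) ∞ Φ
  surjective : Function.Surjective Φ
  surjective_mfderiv : ∀ p : M, Function.Surjective (mfderiv 𝓘(ℝ, E) 𝓘(ℝ, F) Φ p)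
  isometry_horizontal : ∀ (p : M) (v w : TangentSpace 𝓘(ℝ, E) p),
    (∀ k, mfderiv 𝓘(ℝ, E) 𝓘(ℝ, F) Φ p k = 0 → g.inner p v k = 0) →
    (∀ k, mfderiv 𝓘(ℝ, E) 𝓘(ℝ, F) Φ p k = 0 → g.inner p w k = 0) →
    @inner ℝ F _ (mfderiv 𝓘(ℝ, E) 𝓘(ℝ, F) Φ p v) (mfderiv 𝓘(ℝ, E) 𝓘(ℝ, F) Φ p w) =
      g.inner p v w

variable [FiniteDimensional ℝ E]

theorem exists_inner_eq (g : Metric E M) (p : M) (L : TangentSpace 𝓘(ℝ, E) p →L[ℝ] ℝ) :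
    ∃ v : TangentSpace 𝓘(ℝ, E) p, ∀ w, g.inner p v w = L w := by
  have : FiniteDimensional ℝ (TangentSpace 𝓘(ℝ, E) p) := inferInstanceAs (FiniteDimensional ℝ E)
  let B : TangentSpace 𝓘(ℝ, E) p →ₗ[ℝ] Module.Dual ℝ (TangentSpace 𝓘(ℝ, E) p) :=
    { toFun := fun v ↦ (g.inner p v : TangentSpace 𝓘(ℝ, E) p →ₗ[ℝ] ℝ)
      map_add' := fun v w ↦ by ext; simp
      map_smul' := fun c v ↦ by ext; simp }
  have hB : Function.Injective B := by
    rw [injective_iff_map_eq_zero]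
    intro v hv
    by_contra h
    have h1 := g.pos p v h
    have h2 : g.inner p v v = 0 := LinearMap.congr_fun hv v
    exact h1.ne' h2
  obtain ⟨v, hv⟩ := (LinearMap.injective_iff_surjective_of_finrank_eq_finrank
    (Subspace.dual_finrank_eq).symm).1 hB (L : TangentSpace 𝓘(ℝ, E) p →ₗ[ℝ] ℝ)
  exact ⟨v, fun w ↦ LinearMap.congr_fun hv w⟩

/-- The Riemannian gradient of `f : M → ℝ`, characterized by `inner_grad`. -/
def grad (g : Metric E M) (f : M → ℝ) (p : M) : TangentSpace 𝓘(ℝ, E) p :=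
  (exists_inner_eq g p (mfderiv 𝓘(ℝ, E) 𝓘(ℝ, ℝ) f p)).choose

theorem inner_grad (g : Metric E M) (f : M → ℝ) (p : M) (w : TangentSpace 𝓘(ℝ, E) p) :
    g.inner p (grad g f p) w = mfderiv 𝓘(ℝ, E) 𝓘(ℝ, ℝ) f p w :=
  (exists_inner_eq g p (mfderiv 𝓘(ℝ, E) 𝓘(ℝ, ℝ) f p)).choose_spec w

/-- The Riemannian volume density `√(det (g_ij))` at the point with coordinates `x`, in the
preferred chart at `p` and with respect to the linear coordinates of `E` given by a fixed basis. -/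
def density (g : Metric E M) (p : M) (x : E) : ℝ :=
  let e := extChartAt 𝓘(ℝ, E) p
  √(Matrix.det (Matrix.of fun i j ↦
    g.inner (e.symm x)
      (mfderiv 𝓘(ℝ, E) 𝓘(ℝ, E) e.symm x (Module.finBasis ℝ E i))
      (mfderiv 𝓘(ℝ, E) 𝓘(ℝ, E) e.symm x (Module.finBasis ℝ E j))))

/-- The Riemannian divergence of a vector field `X`: in the preferred chart at `p` and with
`ρ = √(det (g_ij))`, this is `ρ⁻¹ ∑ i, ∂ᵢ (ρ Xⁱ)`. The coordinate expression of `X` is its pullback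
under the inverse of the chart, and `∑ i, ∂ᵢ Yⁱ` is the trace of the derivative of `Y`. -/
def divergence (g : Metric E M) (X : ∀ p : M, TangentSpace 𝓘(ℝ, E) p) (p : M) : ℝ :=
  let e := extChartAt 𝓘(ℝ, E) p
  let Y : E → E := VectorField.mpullback 𝓘(ℝ, E) 𝓘(ℝ, E) e.symm X
  (density g p (e p))⁻¹ *
    LinearMap.trace ℝ E (fderiv ℝ (fun x : E ↦ density g p x • Y x) (e p) : E →ₗ[ℝ] E)

/-- The Laplacian (Laplace-Beltrami operator) on real-valued functions. -/
def laplacian (g : Metric E M) (f : M → ℝ) (p : M) : ℝ :=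
  divergence g (grad g f) p

/-- Harmonic functions on an open subset `U` of `M`. -/
def IsHarmonicOn (g : Metric E M) (f : M → ℝ) (U : Set M) : Prop :=
  ContMDiffOn 𝓘(ℝ, E) 𝓘(ℝ, ℝ) 2 f U ∧ ∀ p ∈ U, laplacian g f p = 0

/-- Harmonic morphisms from a Riemannian manifold to the complex plane with its flat metric: smooth
maps that pull back harmonic functions on open sets to harmonic functions. -/
def IsHarmonicMorphism (g : Metric E M) (φ : M → ℂ) : Prop :=
  ContMDiff 𝓘(ℝ, E) 𝓘(ℝ, ℂ) ∞ φ ∧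
    ∀ (U : Set ℂ) (f : ℂ → ℝ), IsOpen U → (φ ⁻¹' U).Nonempty →
      InnerProductSpace.HarmonicOnNhd f U → IsHarmonicOn g (f ∘ φ) (φ ⁻¹' U)

/-- The Laplacian on complex-valued functions. -/
def tau (g : Metric E M) (φ : M → ℂ) (p : M) : ℂ :=
  laplacian g (fun q ↦ (φ q).re) p + laplacian g (fun q ↦ (φ q).im) p * Complex.I

/-- The operator `κ(φ, ψ) = g(grad φ, grad ψ)` on complex-valued functions, where `g` is extended
to a complex bilinear form on the complexified tangent space. -/
def kappa (g : Metric E M) (φ ψ : M → ℂ) (p : M) : ℂ :=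
  let a := grad g (fun q ↦ (φ q).re) p
  let b := grad g (fun q ↦ (φ q).im) p
  let c := grad g (fun q ↦ (ψ q).re) p
  let d := grad g (fun q ↦ (ψ q).im) p
  ((g.inner p a c - g.inner p b d : ℝ) : ℂ) + ((g.inner p a d + g.inner p b c : ℝ) : ℂ) * Complex.I

/-- An orthogonal harmonic family of complex-valued functions. -/
structure IsOrthogonalHarmonicFamily (g : Metric E M) (Ω : Set (M → ℂ)) : Prop where
  contMDiff : ∀ φ ∈ Ω, ContMDiff 𝓘(ℝ, E) 𝓘(ℝ, ℂ) ∞ φ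
  tau_eq_zero : ∀ φ ∈ Ω, ∀ p, tau g φ p = 0
  kappa_eq_zero : ∀ φ ∈ Ω, ∀ ψ ∈ Ω, ∀ p, kappa g φ ψ p = 0

end Riemannian

/-- Isotropic subspaces of `ℂ^n` for the standard symmetric complex bilinear form. -/
def IsIsotropic {n : ℕ} (V : Submodule ℂ (Fin n → ℂ)) : Prop :=
  ∀ v ∈ V, ∀ w ∈ V, v ⬝ᵥ w = 0

/-- The function `x ↦ (Φ(x), v)`, for the standard symmetric complex bilinear form on `ℂ^n`. -/
def component {M : Type*} {n : ℕ} (Φ : M → EuclideanSpace ℝ (Fin n)) (v : Fin n → ℂ) : M → ℂ :=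
  fun x ↦ (fun i ↦ ((Φ x i : ℝ) : ℂ)) ⬝ᵥ v

section LieGroup

variable (E : Type*) [NormedAddCommGroup E] [NormedSpace ℝ E]
  (G : Type*) [TopologicalSpace G] [ChartedSpace E G] [Group G]

/-- The derived algebra `[𝔤, 𝔤]` of the Lie algebra `𝔤` of `G`: the linear span of all brackets. -/
abbrev derivedAlgebra : Submodule ℝ (GroupLieAlgebra 𝓘(ℝ, E) G) :=
  Submodule.span ℝ {Z | ∃ X Y : GroupLieAlgebra 𝓘(ℝ, E) G, Z = ⁅X, Y⁆}

variable {E G}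

/-- A Riemannian metric on `G` is left-invariant if left translations are isometries. -/
def IsLeftInvariant [LieGroup 𝓘(ℝ, E) ∞ G] (g : Metric E G) : Prop :=
  ∀ (a b : G) (v w : TangentSpace 𝓘(ℝ, E) b),
    g.inner (a * b) (mfderiv 𝓘(ℝ, E) 𝓘(ℝ, E) (a * ·) b v) (mfderiv 𝓘(ℝ, E) 𝓘(ℝ, E) (a * ·) b w) =
      g.inner b v w

/-- `Φ : G → ℝ^n` is the natural epimorphism belonging to the linear isomorphism
`ψ : 𝔤 / [𝔤, 𝔤] → ℝ^n`: a surjective homomorphism of Lie groups whose differential at the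
identity is the composition of the quotient map `𝔤 → 𝔤 / [𝔤, 𝔤]` with `ψ`. -/
structure IsNaturalEpimorphism {n : ℕ}
    (ψ : (GroupLieAlgebra 𝓘(ℝ, E) G ⧸ derivedAlgebra E G) ≃ₗ[ℝ] EuclideanSpace ℝ (Fin n))
    (Φ : G → EuclideanSpace ℝ (Fin n)) : Prop where
  contMDiff : ContMDiff 𝓘(ℝ, E) 𝓘(ℝ, EuclideanSpace ℝ (Fin n)) ∞ Φ
  map_mul : ∀ a b : G, Φ (a * b) = Φ a + Φ b
  surjective : Function.Surjective Φ
  mfderiv_one : ∀ X : GroupLieAlgebra 𝓘(ℝ, E) G,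
    mfderiv 𝓘(ℝ, E) 𝓘(ℝ, EuclideanSpace ℝ (Fin n)) Φ 1 X =
      ψ ((derivedAlgebra E G).mkQ X)

end LieGroup

end HarmonicMorphisms

end

open scoped Manifold ContDiff

noncomputable section

namespace HarmonicMorphisms

open Set Filter Topology VectorField Bundle

/-! ### Left-invariant fields and the Maurer–Cartan form in a chart -/

section Frame

variable {E : Type*} [NormedAddCommGroup E] [NormedSpace ℝ E]
  {G : Type*} [TopologicalSpace G] [ChartedSpace E G] [Group G]

/-! The analytic half rests on one computation. Let `g` be left-invariant with $\Phi$ a Riemannian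
submersion. Since $\Phi$ is a homomorphism, the gradient of $\langle u,\Phi\rangle$ is the
left-invariant field $X_u$ whose value at the identity is `componentGrad g Φ u`. The submersion
property gives $d\Phi(X_u)=u$ and $g(X_u,X_w)=\langle u,w\rangle$ (`modelDeriv_componentGrad`,
`innerAt_componentGrad_componentGrad`). For $\phi=\langle a,\Phi\rangle+i\langle b,\Phi\rangle$ and
$f$ of class $C^2$ near the value of $\phi$, $\operatorname{grad}(f\circ\phi)=f_x X_a+f_y X_b$ with
coefficients taken along $\phi$.

A left-invariant field $X_y$ has divergence $-\operatorname{tr}\operatorname{ad}_y$, which vanishes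
because $G$ is nilpotent. So $\Delta(f\circ\phi)=X_a(f_x\circ\phi)+X_b(f_y\circ\phi)$ is a
second-order expression in $f$ with coefficients $\langle a,a\rangle,\langle a,b\rangle,\langle
b,b\rangle$ (`laplacian_comp_complexComponent`). For the real and imaginary parts it is zero, so
$\tau(\phi)=0$. If $v=a+ib$ satisfies $(v,v)=0$, then $a\perp b$ and $|a|=|b|$, and the expression
is $|a|^2\Delta f$; hence the harmonic morphism property. The real and imaginary parts of $(v,w)=0$
are exactly those of $\kappa(\phi_v,\phi_w)=0$.

Nilpotency is assumed of the group, and passes to the Lie algebra through the adjoint action: a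
smooth map into the $i$-th term of the upper central series has its differential at the identity in
`adCenter E G i`, and differentiating $\operatorname{Ad}$ shows that $\operatorname{ad}$ lowers this
series (`hasFDerivAt_groupAd`, `lieOp_mem_adCenter`). This gives `trace_lieAd`. It also gives
$n\ge2$: a Lie algebra spanned by one element modulo brackets would have its brackets pushed down
the series to zero, and a connected group with abelian Lie algebra is commutative.

Existence of $\Phi$: $\psi\circ\pi$ kills brackets, so the left-invariant form it defines is closed.
It has local primitives, which glue because $G$ is simply connected (`exists_glue`), and
left-invariance turns the primitive into a homomorphism (`exists_hom`). The metric is built at the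
identity by splitting $\mathfrak g$ along $d\Phi_e$ and then left-translated. -/

theorem lieGroup_minSmoothness [LieGroup 𝓘(ℝ, E) ∞ G] :
    LieGroup 𝓘(ℝ, E) (minSmoothness ℝ 3) G :=
  LieGroup.of_le (n := ∞) (by simp; exact WithTop.coe_le_coe.2 le_top)

/-- Left-invariant vector fields on a smooth Lie group are smooth. -/
theorem contMDiff_infty_mulInvariantVectorField [LieGroup 𝓘(ℝ, E) ∞ G]
    (v : GroupLieAlgebra 𝓘(ℝ, E) G) :
    ContMDiff 𝓘(ℝ, E) 𝓘(ℝ, E).tangent ∞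
      (fun (g : G) ↦ (mulInvariantVectorField v g : TangentBundle 𝓘(ℝ, E) G)) := by
  -- The value of the field at $g$ is the image of $(0_g, v)\in T_gG\times T_1G$ under the tangent
  -- map of multiplication, so the field is a composition of smooth maps.
  let fg : G → TangentBundle 𝓘(ℝ, E) G := fun g ↦ TotalSpace.mk' E g 0
  have sfg : ContMDiff 𝓘(ℝ, E) 𝓘(ℝ, E).tangent ∞ fg := contMDiff_zeroSection _ _
  let fv : G → TangentBundle 𝓘(ℝ, E) G := fun _ ↦ TotalSpace.mk' E 1 v
  have sfv : ContMDiff 𝓘(ℝ, E) 𝓘(ℝ, E).tangent ∞ fv := contMDiff_const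
  let F₁ : G → (TangentBundle 𝓘(ℝ, E) G × TangentBundle 𝓘(ℝ, E) G) := fun g ↦ (fg g, fv g)
  have S₁ : ContMDiff 𝓘(ℝ, E) (𝓘(ℝ, E).tangent.prod 𝓘(ℝ, E).tangent) ∞ F₁ := sfg.prodMk sfv
  let F₂ : (TangentBundle 𝓘(ℝ, E) G × TangentBundle 𝓘(ℝ, E) G) →
      TangentBundle (𝓘(ℝ, E).prod 𝓘(ℝ, E)) (G × G) :=
    (equivTangentBundleProd 𝓘(ℝ, E) G 𝓘(ℝ, E) G).symm
  have S₂ : ContMDiff (𝓘(ℝ, E).tangent.prod 𝓘(ℝ, E).tangent) (𝓘(ℝ, E).prod 𝓘(ℝ, E)).tangent ∞ F₂ :=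
    contMDiff_equivTangentBundleProd_symm
  let F₃ : TangentBundle (𝓘(ℝ, E).prod 𝓘(ℝ, E)) (G × G) → TangentBundle 𝓘(ℝ, E) G :=
    tangentMap (𝓘(ℝ, E).prod 𝓘(ℝ, E)) 𝓘(ℝ, E) (fun (p : G × G) ↦ p.1 * p.2)
  have S₃ : ContMDiff (𝓘(ℝ, E).prod 𝓘(ℝ, E)).tangent 𝓘(ℝ, E).tangent ∞ F₃ :=
    ContMDiff.contMDiff_tangentMap (contMDiff_mul 𝓘(ℝ, E) ∞) (m := ∞) le_rfl
  let S := (S₃.comp S₂).comp S₁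
  refine S.congr fun g ↦ ?_
  have h1 := mfderiv_prod_eq_add_apply (I := 𝓘(ℝ, E)) (I' := 𝓘(ℝ, E)) (I'' := 𝓘(ℝ, E))
    (f := fun p : G × G ↦ p.1 * p.2) (p := (g, 1)) (v := ((0 : E), (v : E)))
    ((contMDiff_mul 𝓘(ℝ, E) ∞).mdifferentiableAt (by simp))
  -- The tangent map lands over `g * 1`; the base point is a variable so that substitution
  -- identifies the fibre there with the one over `g`.
  have h2 (c : G) (hc : g * 1 = c) (w : E) (hw : mfderiv 𝓘(ℝ, E) 𝓘(ℝ, E) (g * ·) 1 v = w) :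
      (⟨c, w⟩ : TangentBundle 𝓘(ℝ, E) G) =
        ⟨g * 1, mfderiv 𝓘(ℝ, E) 𝓘(ℝ, E) (g * ·) 1 v⟩ := by
    subst hc hw; rfl
  refine (h2 g (mul_one g) _ rfl).trans ?_
  change _ = (⟨g * 1, mfderiv (𝓘(ℝ, E).prod 𝓘(ℝ, E)) 𝓘(ℝ, E) (fun p : G × G ↦ p.1 * p.2) (g, 1)
    ((0 : E), (v : E))⟩ : TangentBundle 𝓘(ℝ, E) G)
  refine congrArg (fun w : E ↦ (⟨g * 1, w⟩ : TangentBundle 𝓘(ℝ, E) G)) (h1.trans ?_).symm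
  refine (congrArg (· + _) (map_zero _)).trans ?_
  exact zero_add _

/-- The derivative at `b` of left translation by `a`, as an endomorphism of the model space. -/
def mulLeftDeriv (a b : G) : E →L[ℝ] E := mfderiv 𝓘(ℝ, E) 𝓘(ℝ, E) (a * ·) b

/-- The derivative at `x` of the inverse of the preferred chart at `p`. -/
def chartSymmDeriv (p : G) (x : E) : E →L[ℝ] E :=
  mfderiv 𝓘(ℝ, E) 𝓘(ℝ, E) (extChartAt 𝓘(ℝ, E) p).symm x

/-- The derivative at `q` of the preferred chart at `p`. -/
def chartDeriv (p q : G) : E →L[ℝ] E :=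
  mfderiv 𝓘(ℝ, E) 𝓘(ℝ, E) (extChartAt 𝓘(ℝ, E) p) q

/-- The left-invariant frame of `G` in the chart at `p`: it sends an element of the Lie algebra to
the value at `x` of the coordinate expression of the corresponding left-invariant field. -/
def frame (p : G) (x : E) : E →L[ℝ] E :=
  (chartSymmDeriv p x).inverse ∘L mulLeftDeriv ((extChartAt 𝓘(ℝ, E) p).symm x) 1

/-- The left-invariant Maurer-Cartan form in the chart at `p`, the inverse of `frame`. -/
def coframe (p : G) (x : E) : E →L[ℝ] E :=
  let q := (extChartAt 𝓘(ℝ, E) p).symm x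
  mulLeftDeriv q⁻¹ q ∘L chartSymmDeriv p x

variable (G) in
/-- The bracket of the Lie algebra of `G`, as an operation on the model space. -/
def lieOp (y z : E) : E :=
  (Bracket.bracket (L := GroupLieAlgebra 𝓘(ℝ, E) G) (M := GroupLieAlgebra 𝓘(ℝ, E) G) y z)

theorem mfderiv_one_mul (c : G) (v : TangentSpace 𝓘(ℝ, E) c) :
    (mfderiv 𝓘(ℝ, E) 𝓘(ℝ, E) ((1 : G) * ·) c v : E) = v := by
  have h : ((1 : G) * · : G → G) = id := by ext x; simp
  rw [h, mfderiv_id]; rfl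

variable [LieGroup 𝓘(ℝ, E) ∞ G]

theorem mdifferentiableAt_mul_left (a b : G) :
    MDifferentiableAt 𝓘(ℝ, E) 𝓘(ℝ, E) (a * ·) b :=
  (contMDiff_mul_left (I := 𝓘(ℝ, E)) (n := ∞)).mdifferentiableAt (by simp)

theorem mfderiv_mul_left_comp (a b c : G) (v : TangentSpace 𝓘(ℝ, E) c) :
    mfderiv 𝓘(ℝ, E) 𝓘(ℝ, E) (a * ·) (b * c) (mfderiv 𝓘(ℝ, E) 𝓘(ℝ, E) (b * ·) c v) =
      mfderiv 𝓘(ℝ, E) 𝓘(ℝ, E) (a * b * ·) c v := by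
  have h : (a * b * · : G → G) = (a * ·) ∘ (b * ·) := by ext x; simp [mul_assoc]
  rw [h, mfderiv_comp c (mdifferentiableAt_mul_left a (b * c)) (mdifferentiableAt_mul_left b c)]
  rfl

theorem mulLeftDeriv_comp (a b c : G) :
    mulLeftDeriv a (b * c) ∘L mulLeftDeriv b c = mulLeftDeriv (E := E) (a * b) c := by
  ext v; exact mfderiv_mul_left_comp a b c v

omit [LieGroup 𝓘(ℝ, E) ∞ G] in
theorem mulLeftDeriv_one_left (c : G) :
    mulLeftDeriv (1 : G) c = ContinuousLinearMap.id ℝ E := by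
  ext v; exact mfderiv_one_mul c v

theorem mulLeftDeriv_inv_comp (a : G) :
    mulLeftDeriv a⁻¹ a ∘L mulLeftDeriv a 1 = ContinuousLinearMap.id ℝ E := by
  have := mulLeftDeriv_comp (E := E) a⁻¹ a 1
  rwa [mul_one, inv_mul_cancel, mulLeftDeriv_one_left] at this

theorem mulLeftDeriv_comp_inv (a : G) :
    mulLeftDeriv a 1 ∘L mulLeftDeriv a⁻¹ a = ContinuousLinearMap.id ℝ E := by
  have := mulLeftDeriv_comp (E := E) a a⁻¹ a
  rwa [inv_mul_cancel, mul_inv_cancel, mulLeftDeriv_one_left] at this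

theorem chartDeriv_comp_chartSymmDeriv {p : G} {x : E} (hx : x ∈ (extChartAt 𝓘(ℝ, E) p).target) :
    chartDeriv p ((extChartAt 𝓘(ℝ, E) p).symm x) ∘L chartSymmDeriv p x =
      ContinuousLinearMap.id ℝ E := by
  have := mfderiv_extChartAt_comp_mfderivWithin_extChartAt_symm (I := 𝓘(ℝ, E)) hx
  simp only [modelWithCornersSelf_coe, range_id, mfderivWithin_univ] at this
  exact this

theorem chartSymmDeriv_comp_chartDeriv {p : G} {x : E} (hx : x ∈ (extChartAt 𝓘(ℝ, E) p).target) :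
    chartSymmDeriv p x ∘L chartDeriv p ((extChartAt 𝓘(ℝ, E) p).symm x) =
      ContinuousLinearMap.id ℝ E := by
  have := mfderivWithin_extChartAt_symm_comp_mfderiv_extChartAt (I := 𝓘(ℝ, E)) hx
  simp only [modelWithCornersSelf_coe, range_id, mfderivWithin_univ] at this
  exact this

theorem isInvertible_chartSymmDeriv {p : G} {x : E} (hx : x ∈ (extChartAt 𝓘(ℝ, E) p).target) :
    (chartSymmDeriv p x).IsInvertible :=
  .of_inverse (chartSymmDeriv_comp_chartDeriv hx) (chartDeriv_comp_chartSymmDeriv hx)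

theorem inverse_chartSymmDeriv {p : G} {x : E} (hx : x ∈ (extChartAt 𝓘(ℝ, E) p).target) :
    (chartSymmDeriv p x).inverse = chartDeriv p ((extChartAt 𝓘(ℝ, E) p).symm x) :=
  ContinuousLinearMap.inverse_eq (chartSymmDeriv_comp_chartDeriv hx)
    (chartDeriv_comp_chartSymmDeriv hx)

theorem frame_eq {p : G} {x : E} (hx : x ∈ (extChartAt 𝓘(ℝ, E) p).target) :
    frame p x = chartDeriv p ((extChartAt 𝓘(ℝ, E) p).symm x) ∘L
      mulLeftDeriv ((extChartAt 𝓘(ℝ, E) p).symm x) 1 := by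
  rw [frame, inverse_chartSymmDeriv hx]

theorem chartSymmDeriv_comp_frame {p : G} {x : E} (hx : x ∈ (extChartAt 𝓘(ℝ, E) p).target) :
    chartSymmDeriv p x ∘L frame p x = mulLeftDeriv ((extChartAt 𝓘(ℝ, E) p).symm x) 1 := by
  rw [frame_eq hx, ← ContinuousLinearMap.comp_assoc, chartSymmDeriv_comp_chartDeriv hx,
    ContinuousLinearMap.id_comp]

theorem coframe_comp_frame {p : G} {x : E} (hx : x ∈ (extChartAt 𝓘(ℝ, E) p).target) :
    coframe p x ∘L frame p x = ContinuousLinearMap.id ℝ E := by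
  rw [coframe, ContinuousLinearMap.comp_assoc, chartSymmDeriv_comp_frame hx, mulLeftDeriv_inv_comp]

theorem frame_comp_coframe {p : G} {x : E} (hx : x ∈ (extChartAt 𝓘(ℝ, E) p).target) :
    frame p x ∘L coframe p x = ContinuousLinearMap.id ℝ E := by
  rw [frame_eq hx, coframe, ContinuousLinearMap.comp_assoc,
    ← ContinuousLinearMap.comp_assoc _ _ (chartSymmDeriv p x), mulLeftDeriv_comp_inv,
    ContinuousLinearMap.id_comp, chartDeriv_comp_chartSymmDeriv hx]

theorem mulLeftDeriv_comp_coframe {p : G} {x : E} (hx : x ∈ (extChartAt 𝓘(ℝ, E) p).target) :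
    mulLeftDeriv ((extChartAt 𝓘(ℝ, E) p).symm x) 1 ∘L coframe p x = chartSymmDeriv p x := by
  rw [← chartSymmDeriv_comp_frame hx, ContinuousLinearMap.comp_assoc, frame_comp_coframe hx,
    ContinuousLinearMap.comp_id]

theorem contDiffAt_frame_apply [CompleteSpace E] {p : G} {x : E}
    (hx : x ∈ (extChartAt 𝓘(ℝ, E) p).target) (z : E) :
    ContDiffAt ℝ ∞ (fun x ↦ frame p x z) x := by
  have h1 : ContMDiffAt 𝓘(ℝ, E) 𝓘(ℝ, E) ∞ (extChartAt 𝓘(ℝ, E) p).symm x :=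
    (contMDiffOn_extChartAt_symm p).contMDiffAt ((isOpen_extChartAt_target p).mem_nhds hx)
  have hi := isInvertible_chartSymmDeriv hx
  have h2 := ContMDiffAt.mpullback_vectorField_preimage (I := 𝓘(ℝ, E)) (I' := 𝓘(ℝ, E))
    (contMDiff_infty_mulInvariantVectorField (G := G) (show GroupLieAlgebra 𝓘(ℝ, E) G from z) _) h1
    hi (by simp)
  exact (contMDiffAt_vectorSpace_iff_contDiffAt (E := E) (V := fun x ↦ frame p x z)).1 h2

theorem contDiffOn_frame [FiniteDimensional ℝ E] (p : G) :
    ContDiffOn ℝ ∞ (frame p) (extChartAt 𝓘(ℝ, E) p).target := by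
  have : CompleteSpace E := FiniteDimensional.complete ℝ E
  exact contDiffOn_clm_apply.2 fun z x hx ↦ (contDiffAt_frame_apply hx z).contDiffWithinAt

theorem contDiffAt_frame [FiniteDimensional ℝ E] {p : G} {x : E}
    (hx : x ∈ (extChartAt 𝓘(ℝ, E) p).target) : ContDiffAt ℝ ∞ (frame p) x :=
  (contDiffOn_frame p).contDiffAt ((isOpen_extChartAt_target p).mem_nhds hx)

/-- Pullback by the inverse chart commutes with Lie brackets, and the bracket of two left-invariant
fields is the left-invariant field of the Lie algebra bracket. -/
theorem lieBracket_frame [CompleteSpace E] {p : G} {x : E}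
    (hx : x ∈ (extChartAt 𝓘(ℝ, E) p).target) (y z : E) :
    lieBracket ℝ (fun x ↦ frame p x y) (fun x ↦ frame p x z) x =
      frame p x (lieOp G y z) := by
  have h1 : ContMDiffAt 𝓘(ℝ, E) 𝓘(ℝ, E) ∞ (extChartAt 𝓘(ℝ, E) p).symm x :=
    (contMDiffOn_extChartAt_symm p).contMDiffAt ((isOpen_extChartAt_target p).mem_nhds hx)
  have := lieGroup_minSmoothness (E := E) (G := G)
  let y' : GroupLieAlgebra 𝓘(ℝ, E) G := y
  let z' : GroupLieAlgebra 𝓘(ℝ, E) G := z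
  have h2 := mpullback_mlieBracket (mdifferentiableAt_mulInvariantVectorField y')
    (mdifferentiableAt_mulInvariantVectorField z') h1
    (by simp; exact WithTop.coe_le_coe.2 le_top)
  rw [← mulInvariantVector_mlieBracket y' z'] at h2
  have h3 := congrFun (mlieBracketWithin_eq_lieBracketWithin (𝕜 := ℝ) (E := E) (s := univ)
    (V := fun x ↦ frame p x y) (W := fun x ↦ frame p x z)) x
  rw [lieBracketWithin_univ] at h3
  exact (h2.trans h3).symm

/-- The structure equation of the frame. It drives the divergence formula, the derivative of the
adjoint action and the closedness of left-invariant forms. -/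
theorem fderiv_frame_sub [FiniteDimensional ℝ E] {p : G} {x : E}
    (hx : x ∈ (extChartAt 𝓘(ℝ, E) p).target) (y z : E) :
    fderiv ℝ (frame p) x (frame p x y) z - fderiv ℝ (frame p) x (frame p x z) y =
      frame p x (lieOp G y z) := by
  have : CompleteSpace E := FiniteDimensional.complete ℝ E
  have hd : DifferentiableAt ℝ (frame p) x := (contDiffAt_frame hx).differentiableAt (by simp)
  rw [← lieBracket_frame hx, lieBracket_eq]
  beta_reduce
  rw [fderiv_clm_apply hd (by fun_prop),
    fderiv_clm_apply hd (by fun_prop)]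
  simp

end Frame

/-! ### Derivative of the determinant -/

section Determinant

variable {E : Type*} [NormedAddCommGroup E] [NormedSpace ℝ E] [FiniteDimensional ℝ E]

theorem differentiable_det : Differentiable ℝ fun f : E →L[ℝ] E ↦ f.det := by
  let b := Module.finBasis ℝ E
  have h : (fun f : E →L[ℝ] E ↦ f.det) =
      fun f ↦ ∑ σ : Equiv.Perm (Fin (Module.finrank ℝ E)),
        (Equiv.Perm.sign σ : ℝ) * ∏ i, b.coord (σ i) (f (b i)) := by
    ext f
    rw [ContinuousLinearMap.det, ← LinearMap.det_toMatrix b, Matrix.det_apply']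
    simp [LinearMap.toMatrix_apply]
  rw [h]
  have h1 (i j) : Differentiable ℝ fun f : E →L[ℝ] E ↦ b.coord i (f (b j)) :=
    ((b.coord i).toContinuousLinearMap ∘L ContinuousLinearMap.apply ℝ E (b j)).differentiable
  fun_prop

/-- Along the line $1+tM$ the determinant is $1+t\operatorname{tr}M+O(t^2)$, with a polynomial
remainder. -/
theorem fderiv_det_one (M : E →L[ℝ] E) :
    fderiv ℝ (fun f : E →L[ℝ] E ↦ f.det) 1 M = LinearMap.trace ℝ E M := by
  let b := Module.finBasis ℝ E
  have h1 : HasDerivAt (fun t : ℝ ↦ (1 + t • M : E →L[ℝ] E)) M 0 := by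
    simpa using ((hasDerivAt_id (0 : ℝ)).smul_const M).const_add 1
  have h2 : HasDerivAt (fun t : ℝ ↦ (1 + t • M : E →L[ℝ] E).det)
      (fderiv ℝ (fun f : E →L[ℝ] E ↦ f.det) 1 M) 0 := by
    have := (differentiable_det (E := E) (1 + (0 : ℝ) • M)).hasFDerivAt.comp_hasDerivAt 0 h1
    rw [zero_smul, add_zero] at this
    exact this
  let N := LinearMap.toMatrix b b M
  let q := (Matrix.det (1 + (Polynomial.X : Polynomial ℝ) • N.map Polynomial.C)).divX.divX
  have h3 (t : ℝ) : (1 + t • M : E →L[ℝ] E).det = 1 + N.trace * t + q.eval t * t ^ 2 := by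
    rw [← Matrix.det_one_add_smul, ContinuousLinearMap.det, ← LinearMap.det_toMatrix b]
    simp [N, map_add, LinearMap.toMatrix_one]
  have h4 : HasDerivAt (fun t : ℝ ↦ 1 + N.trace * t + q.eval t * t ^ 2) N.trace 0 := by
    have :=  ((((hasDerivAt_id (0 : ℝ)).const_mul N.trace).const_add 1).add
      ((q.hasDerivAt 0).mul ((hasDerivAt_id (0 : ℝ)).pow 2)))
    simp only [mul_one, ne_eq, OfNat.ofNat_ne_zero, not_false_eq_true, id_eq, zero_pow, mul_zero,
      pow_one, add_zero, Nat.add_one_sub_one, Pi.pow_apply] at this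
    exact this
  rw [LinearMap.trace_eq_matrix_trace ℝ b]
  refine h2.unique ?_
  simpa only [h3] using h4

/-- The derivative of the absolute value of the determinant of a family of endomorphisms. -/
theorem hasFDerivAt_abs_det {A : E → E →L[ℝ] E} {A' : E →L[ℝ] E →L[ℝ] E} {x : E} {B : E →L[ℝ] E}
    (hA : HasFDerivAt A A' x) (hAB : A x ∘L B = .id ℝ E) (hBA : B ∘L A x = .id ℝ E) :
    ∃ L : E →L[ℝ] ℝ, HasFDerivAt (fun y ↦ |(A y).det|) L x ∧
      ∀ v, L v = |(A x).det| * LinearMap.trace ℝ E (B ∘L A' v : E →L[ℝ] E) := by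
  have hmul (f g : E →L[ℝ] E) : (f ∘L g).det = f.det * g.det := LinearMap.det_comp _ _
  have hid : (ContinuousLinearMap.id ℝ E).det = 1 := LinearMap.det_id
  let T : (E →L[ℝ] E) →L[ℝ] (E →L[ℝ] E) := ContinuousLinearMap.compL ℝ E E E B
  have h1 : HasFDerivAt (fun y ↦ B ∘L A y) (T ∘L A') x := T.hasFDerivAt.comp x hA
  have h2 : HasFDerivAt (fun y ↦ (B ∘L A y).det)
      (fderiv ℝ (fun f : E →L[ℝ] E ↦ f.det) 1 ∘L (T ∘L A')) x := by
    have h0 : B ∘L A x = 1 := hBA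
    have := (differentiable_det (E := E) (B ∘L A x)).hasFDerivAt.comp x h1
    rwa [h0] at this
  -- Near $x$ the determinant of $B\circ A(y)$ is positive, so $|\det A(y)|=|\det A(x)|\det(B\circ
  -- A(y))$ and the absolute value disappears from the differentiation.
  have h3 : ∀ᶠ y in 𝓝 x, 0 < (B ∘L A y).det := by
    apply h2.continuousAt.eventually (p := fun t ↦ 0 < t)
    exact lt_mem_nhds (by beta_reduce; rw [hBA, hid]; exact one_pos)
  refine ⟨|(A x).det| • (fderiv ℝ (fun f : E →L[ℝ] E ↦ f.det) 1 ∘L (T ∘L A')), ?_, fun v ↦ ?_⟩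
  · refine (h2.const_mul |(A x).det|).congr_of_eventuallyEq ?_
    filter_upwards [h3] with y hy
    rw [← abs_of_pos hy, ← abs_mul, ← hmul, ← ContinuousLinearMap.comp_assoc, hAB,
      ContinuousLinearMap.id_comp]
  · simp [fderiv_det_one, T]

end Determinant

/-! ### Divergence of left-invariant fields -/

section Divergence

variable {E : Type*} [NormedAddCommGroup E] [NormedSpace ℝ E]
  {G : Type*} [TopologicalSpace G] [ChartedSpace E G] [Group G] [LieGroup 𝓘(ℝ, E) ∞ G]

variable (G) in
/-- The adjoint representation of the Lie algebra of `G`, on the model space. -/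
def lieAd [CompleteSpace E] (y : E) : E →ₗ[ℝ] E where
  toFun := lieOp G y
  map_add' a b := by
    have := lieGroup_minSmoothness (E := E) (G := G)
    exact lie_add (L := GroupLieAlgebra 𝓘(ℝ, E) G) (M := GroupLieAlgebra 𝓘(ℝ, E) G) y a b
  map_smul' c a := by
    have := lieGroup_minSmoothness (E := E) (G := G)
    exact lie_smul (L := GroupLieAlgebra 𝓘(ℝ, E) G) (M := GroupLieAlgebra 𝓘(ℝ, E) G) c y a

variable [FiniteDimensional ℝ E]

omit [FiniteDimensional ℝ E] in
theorem coframe_eq_inverse {p : G} {x : E} (hx : x ∈ (extChartAt 𝓘(ℝ, E) p).target) :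
    coframe p x = (frame p x).inverse :=
  (ContinuousLinearMap.inverse_eq (frame_comp_coframe hx) (coframe_comp_frame hx)).symm

theorem contDiffAt_coframe {p : G} {x : E} (hx : x ∈ (extChartAt 𝓘(ℝ, E) p).target) :
    ContDiffAt ℝ ∞ (coframe p) x := by
  have : CompleteSpace E := FiniteDimensional.complete ℝ E
  have hinv : (frame p x).IsInvertible := .of_inverse (frame_comp_coframe hx) (coframe_comp_frame hx)
  refine (hinv.contDiffAt_map_inverse.comp x (contDiffAt_frame hx)).congr_of_eventuallyEq ?_
  filter_upwards [(isOpen_extChartAt_target (I := 𝓘(ℝ, E)) p).mem_nhds hx] with y hy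
  exact coframe_eq_inverse hy

/-- Differentiate the identity that coframe after frame is constant, then compose with the coframe
on the right. -/
theorem fderiv_coframe {p : G} {x : E} (hx : x ∈ (extChartAt 𝓘(ℝ, E) p).target) (v : E) :
    fderiv ℝ (coframe p) x v = -(coframe p x ∘L fderiv ℝ (frame p) x v ∘L coframe p x) := by
  have h1 := ((contDiffAt_coframe hx).differentiableAt (by simp)).hasFDerivAt
  have h2 := ((contDiffAt_frame hx).differentiableAt (by simp)).hasFDerivAt
  have h3 := h1.clm_comp h2
  have h4 : (fun y ↦ coframe p y ∘L frame p y) =ᶠ[𝓝 x] fun _ ↦ ContinuousLinearMap.id ℝ E := by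
    filter_upwards [(isOpen_extChartAt_target (I := 𝓘(ℝ, E)) p).mem_nhds hx] with y hy
    exact coframe_comp_frame hy
  have h5 := h3.unique ((hasFDerivAt_const _ x).congr_of_eventuallyEq h4)
  have h6 : coframe p x ∘L fderiv ℝ (frame p) x v + fderiv ℝ (coframe p) x v ∘L frame p x = 0 := by
    simpa using DFunLike.congr_fun h5 v
  have h7 := congrArg (· ∘L coframe p x) h6
  simp only [ContinuousLinearMap.add_comp, ContinuousLinearMap.comp_assoc, frame_comp_coframe hx,
    ContinuousLinearMap.comp_id, ContinuousLinearMap.zero_comp] at h7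
  exact eq_neg_of_add_eq_zero_right h7

/-- The divergence of a left-invariant vector field for the density `|det (coframe)|` is minus the
trace of its adjoint endomorphism. -/
theorem trace_fderiv_smul_frame [CompleteSpace E] {p : G} {x : E}
    (hx : x ∈ (extChartAt 𝓘(ℝ, E) p).target) (y : E) :
    DifferentiableAt ℝ (fun x ↦ |(coframe p x).det|) x ∧
    LinearMap.trace ℝ E
      (fderiv ℝ (fun x ↦ |(coframe p x).det| • frame p x y) x : E →L[ℝ] E) =
      - (|(coframe p x).det| * LinearMap.trace ℝ E (lieAd G y)) := by
  have h1 := ((contDiffAt_coframe hx).differentiableAt (by simp)).hasFDerivAt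
  have h2 := ((contDiffAt_frame hx).differentiableAt (by simp)).hasFDerivAt
  obtain ⟨L, hL, hLv⟩ := hasFDerivAt_abs_det h1 (coframe_comp_frame hx) (frame_comp_coframe hx)
  refine ⟨hL.differentiableAt, ?_⟩
  have h3 := h2.clm_apply (hasFDerivAt_const y x)
  have h4 := hL.smul h3
  have h4' : fderiv ℝ (fun x ↦ |(coframe p x).det| • frame p x y) x = _ := h4.fderiv
  rw [h4']
  set D : E →L[ℝ] E := fderiv ℝ (frame p) x (frame p x y) with hD
  -- Write $w=F z$ with $F$ the frame; the structure equation exchanges the derivative of $F y$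
  -- along $F z$ for that of $F z$ along $F y$, at the cost of $F[y,z]$.
  have h5 : ((fderiv ℝ (frame p) x).flip y : E →ₗ[ℝ] E) =
      (D ∘L coframe p x : E →L[ℝ] E) -
        (frame p x : E →ₗ[ℝ] E) ∘ₗ lieAd G y ∘ₗ (coframe p x : E →ₗ[ℝ] E) := by
    ext w
    have h6 : w = frame p x (coframe p x w) :=
      (DFunLike.congr_fun (frame_comp_coframe hx) w).symm
    have h7 := fderiv_frame_sub hx y (coframe p x w)
    rw [← h6] at h7
    simp only [ContinuousLinearMap.coe_coe, ContinuousLinearMap.flip_apply, LinearMap.sub_apply,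
      ContinuousLinearMap.comp_apply, LinearMap.comp_apply]
    rw [hD, eq_sub_iff_add_eq']
    exact (sub_eq_iff_eq_add.1 h7).symm
  have h8 : LinearMap.trace ℝ E ((fderiv ℝ (frame p) x).flip y : E →L[ℝ] E) =
      LinearMap.trace ℝ E (D ∘L coframe p x : E →L[ℝ] E) - LinearMap.trace ℝ E (lieAd G y) := by
    rw [h5, map_sub, ← LinearMap.comp_assoc, LinearMap.trace_comp_comm', ← LinearMap.comp_assoc,
      ← ContinuousLinearMap.toLinearMap_comp, coframe_comp_frame hx]
    simp
  -- The derivative of the density along the field cancels the trace of $D$ composed with the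
  -- coframe from `h8`; only the trace of the adjoint endomorphism survives.
  have h9 : L (frame p x y) =
      -(|(coframe p x).det| * LinearMap.trace ℝ E (D ∘L coframe p x : E →L[ℝ] E)) := by
    rw [hLv, fderiv_coframe hx, ← hD, ContinuousLinearMap.comp_neg,
      ← ContinuousLinearMap.comp_assoc, frame_comp_coframe hx, ContinuousLinearMap.id_comp]
    simp
  have h10 : LinearMap.trace ℝ E (L.smulRight (frame p x y) : E →L[ℝ] E) = L (frame p x y) :=
    LinearMap.trace_smulRight (L : E →ₗ[ℝ] ℝ) (frame p x y)
  simp only [ContinuousLinearMap.comp_zero, zero_add, ContinuousLinearMap.toLinearMap_add,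
    ContinuousLinearMap.toLinearMap_smul, map_add, map_smul, h8, h10, h9, smul_eq_mul]
  ring

end Divergence

/-! ### Gradients on the model space -/

section Gradient

variable {E : Type*} [NormedAddCommGroup E] [NormedSpace ℝ E]
  {M : Type*} [TopologicalSpace M] [ChartedSpace E M]

/-- The differential of a function with values in a normed space, on the model space. -/
def modelDeriv {F : Type*} [NormedAddCommGroup F] [NormedSpace ℝ F] (f : M → F) (p : M) :
    E →L[ℝ] F := mfderiv 𝓘(ℝ, E) 𝓘(ℝ, F) f p

variable [IsManifold 𝓘(ℝ, E) ∞ M]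

/-- The inner product of a Riemannian metric, as a function on the model space. -/
def innerAt (g : Metric E M) (p : M) (v w : E) : ℝ := g.inner p v w

theorem grad_eq [FiniteDimensional ℝ E] (g : Metric E M) {f : M → ℝ} {p : M} {v : E}
    (h : ∀ w : E, innerAt g p v w = modelDeriv f p w) : grad g f p = v := by
  let v' : TangentSpace 𝓘(ℝ, E) p := v
  by_contra hne
  set d := grad g f p - v' with hd
  have h1 : 0 < g.inner p d d := g.pos p d (sub_ne_zero.2 hne)
  have h2 : g.inner p d d = g.inner p (grad g f p) d - g.inner p v' d :=
    DFunLike.congr_fun (map_sub (g.inner p) _ _) d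
  have h3 : g.inner p (grad g f p) d = g.inner p v' d := (inner_grad g f p d).trans (h d).symm
  rw [h2, h3, sub_self] at h1
  exact lt_irrefl _ h1

end Gradient

/-! ### Density and divergence for a left-invariant metric -/

section LeftInvariant

variable {E : Type*} [NormedAddCommGroup E] [NormedSpace ℝ E]
  {G : Type*} [TopologicalSpace G] [ChartedSpace E G] [Group G] [LieGroup 𝓘(ℝ, E) ∞ G]

theorem innerAt_mulLeftDeriv {g : Metric E G} (hg : IsLeftInvariant g) (a : G) (v w : E) :
    innerAt g a (mulLeftDeriv a 1 v) (mulLeftDeriv a 1 w) = innerAt g 1 v w := by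
  have h : ∀ c, a * 1 = c → innerAt g c (mulLeftDeriv a 1 v) (mulLeftDeriv a 1 w) =
      innerAt g 1 v w := by
    rintro c rfl
    exact hg a 1 v w
  exact h a (mul_one a)

/-- The inner product at the identity as a bilinear form. -/
def innerOne (g : Metric E G) : LinearMap.BilinForm ℝ E :=
  LinearMap.mk₂ ℝ (innerAt g 1)
    (fun a b c ↦ by simp only [innerAt]; exact congrArg (· c) ((g.inner 1).map_add a b))
    (fun r b c ↦ by simp only [innerAt]; exact congrArg (· c) ((g.inner 1).map_smul r b))
    (fun a b c ↦ (g.inner 1 a).map_add b c) (fun r b c ↦ (g.inner 1 b).map_smul r c)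

variable [FiniteDimensional ℝ E]

/-- In a chart, the Riemannian density of a left-invariant metric is a constant multiple of
`|det (coframe)|`. -/
theorem density_eq {g : Metric E G} (hg : IsLeftInvariant g) {p : G} {x : E}
    (hx : x ∈ (extChartAt 𝓘(ℝ, E) p).target) :
    density g p x =
      √(LinearMap.BilinForm.toMatrix (Module.finBasis ℝ E) (innerOne g)).det *
        |(coframe p x).det| := by
  set b := Module.finBasis ℝ E
  set N := LinearMap.toMatrix b b (coframe p x)
  -- The derivative of the inverse chart is a left translation after the coframe, so left-invariance
  -- moves the Gram matrix to the identity.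
  have h1 : (Matrix.of fun i j ↦ innerAt g ((extChartAt 𝓘(ℝ, E) p).symm x)
      (chartSymmDeriv p x (b i)) (chartSymmDeriv p x (b j))) =
      N.transpose * LinearMap.BilinForm.toMatrix b (innerOne g) * N := by
    rw [← LinearMap.BilinForm.toMatrix_comp b b]
    ext i j
    rw [Matrix.of_apply, ← mulLeftDeriv_comp_coframe hx, ContinuousLinearMap.comp_apply,
      ContinuousLinearMap.comp_apply, innerAt_mulLeftDeriv hg, LinearMap.BilinForm.toMatrix_apply]
    rfl
  have h2 : density g p x = √(N.transpose * LinearMap.BilinForm.toMatrix b (innerOne g) * N).det :=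
    congrArg (fun m ↦ √(Matrix.det m)) h1
  have h3 : N.det = (coframe p x).det := LinearMap.det_toMatrix b _
  -- Positivity of the Gram determinant is not needed: $\sqrt{s^2t}=|s|\sqrt t$ requires only
  -- $s^2\ge0$.
  rw [h2, Matrix.det_mul, Matrix.det_mul, Matrix.det_transpose, h3,
    show ∀ s t : ℝ, s * t * s = s ^ 2 * t by intro s t; ring, Real.sqrt_mul (sq_nonneg _),
    Real.sqrt_sq_eq_abs, mul_comm]

theorem trace_fderiv_smul {H : E → ℝ} {Z : E → E} {x : E} (hH : DifferentiableAt ℝ H x)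
    (hZ : DifferentiableAt ℝ Z x) :
    LinearMap.trace ℝ E (fderiv ℝ (fun y ↦ H y • Z y) x : E →L[ℝ] E) =
      H x * LinearMap.trace ℝ E (fderiv ℝ Z x : E →L[ℝ] E) + fderiv ℝ H x (Z x) := by
  have h : fderiv ℝ (fun y ↦ H y • Z y) x = _ := fderiv_smul hH hZ
  have h10 : LinearMap.trace ℝ E ((fderiv ℝ H x).smulRight (Z x) : E →L[ℝ] E) =
      fderiv ℝ H x (Z x) := LinearMap.trace_smulRight (fderiv ℝ H x : E →ₗ[ℝ] ℝ) (Z x)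
  rw [h, ContinuousLinearMap.toLinearMap_add, ContinuousLinearMap.toLinearMap_smul, map_add,
    map_smul, h10, smul_eq_mul]

/-- The divergence of a combination of two left-invariant vector fields on a unimodular group. -/
theorem divergence_eq [CompleteSpace E] (htr : ∀ y : E, LinearMap.trace ℝ E (lieAd G y) = 0)
    {g : Metric E G} (hg : IsLeftInvariant g) {X : ∀ q : G, TangentSpace 𝓘(ℝ, E) q} {p : G}
    {h₁ h₂ : G → ℝ} {a b : E}
    (hX : ∀ᶠ q in 𝓝 p, X q = (h₁ q • mulLeftDeriv q 1 a + h₂ q • mulLeftDeriv q 1 b : E))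
    (hh₁ : MDifferentiableAt 𝓘(ℝ, E) 𝓘(ℝ, ℝ) h₁ p)
    (hh₂ : MDifferentiableAt 𝓘(ℝ, E) 𝓘(ℝ, ℝ) h₂ p) :
    divergence g X p = (density g p (extChartAt 𝓘(ℝ, E) p p))⁻¹ *
      density g p (extChartAt 𝓘(ℝ, E) p p) *
      (modelDeriv h₁ p (mulLeftDeriv p 1 a) +
        modelDeriv h₂ p (mulLeftDeriv p 1 b)) := by
  set e := extChartAt 𝓘(ℝ, E) p with he
  set c := √(LinearMap.BilinForm.toMatrix (Module.finBasis ℝ E) (innerOne g)).det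
  have hp : e p ∈ e.target := mem_extChartAt_target p
  have hnhds : e.target ∈ 𝓝 (e p) := (isOpen_extChartAt_target (I := 𝓘(ℝ, E)) p).mem_nhds hp
  have hep : e.symm (e p) = p := extChartAt_to_inv p
  have hsymm : MDifferentiableAt 𝓘(ℝ, E) 𝓘(ℝ, E) e.symm (e p) :=
    ((contMDiffOn_extChartAt_symm (I := 𝓘(ℝ, E)) (n := ∞) p).contMDiffAt hnhds).mdifferentiableAt
      (by simp)
  have hY : (fun x ↦ density g p x • mpullback 𝓘(ℝ, E) 𝓘(ℝ, E) e.symm X x) =ᶠ[𝓝 (e p)]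
      fun x ↦ (c * h₁ (e.symm x)) • (|(coframe p x).det| • frame p x a) +
        (c * h₂ (e.symm x)) • (|(coframe p x).det| • frame p x b) := by
    have hc : Tendsto e.symm (𝓝 (e p)) (𝓝 p) := by
      simpa [hep] using hsymm.continuousAt.tendsto
    filter_upwards [hc.eventually hX, hnhds] with x hx hxt
    have h1 : mpullback 𝓘(ℝ, E) 𝓘(ℝ, E) e.symm X x =
        (chartSymmDeriv p x).inverse (X (e.symm x)) := rfl
    rw [density_eq hg hxt]
    refine (congrArg (fun z : E ↦ (c * |(coframe p x).det|) • z) (h1.trans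
      (congrArg (chartSymmDeriv p x).inverse hx))).trans ?_
    have h2 (z : E) : (chartSymmDeriv p x).inverse (mulLeftDeriv (e.symm x) 1 z) = frame p x z :=
      rfl
    rw [map_add, map_smul, map_smul, h2, h2]
    module
  have key (h : G → ℝ) (z : E) (hh : MDifferentiableAt 𝓘(ℝ, E) 𝓘(ℝ, ℝ) h p) :
      DifferentiableAt ℝ (fun x ↦ (c * h (e.symm x)) • (|(coframe p x).det| • frame p x z)) (e p) ∧
      LinearMap.trace ℝ E (fderiv ℝ (fun x ↦ (c * h (e.symm x)) •
        (|(coframe p x).det| • frame p x z)) (e p) : E →L[ℝ] E) =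
      density g p (e p) * modelDeriv h p (mulLeftDeriv p 1 z) := by
    obtain ⟨hF, htrF⟩ := trace_fderiv_smul_frame hp z
    have hd : DifferentiableAt ℝ (fun x ↦ |(coframe p x).det| • frame p x z) (e p) :=
      hF.smul (((contDiffAt_frame hp).differentiableAt (by simp)).clm_apply (by fun_prop))
    have hh' : MDifferentiableAt 𝓘(ℝ, E) 𝓘(ℝ, ℝ) h (e.symm (e p)) := by rwa [hep]
    have hcomp : MDifferentiableAt 𝓘(ℝ, E) 𝓘(ℝ, ℝ) (h ∘ e.symm) (e p) := hh'.comp (e p) hsymm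
    have hcd : DifferentiableAt ℝ (fun x ↦ h (e.symm x)) (e p) := hcomp.differentiableAt
    have hH : DifferentiableAt ℝ (fun x ↦ c * h (e.symm x)) (e p) := hcd.const_mul c
    refine ⟨hH.smul hd, ?_⟩
    have hfd (w : E) : fderiv ℝ (fun x ↦ c * h (e.symm x)) (e p) w =
        c * modelDeriv h (e.symm (e p)) (chartSymmDeriv p (e p) w) := by
      rw [fderiv_const_mul hcd]
      have := mfderiv_comp (e p) hh' hsymm
      rw [mfderiv_eq_fderiv] at this
      have h3 : fderiv ℝ (fun x ↦ h (e.symm x)) (e p) w = _ := DFunLike.congr_fun this w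
      simp only [smul_apply, h3]
      rfl
    have h4 : chartSymmDeriv p (e p) (frame p (e p) z) = mulLeftDeriv (e.symm (e p)) 1 z :=
      DFunLike.congr_fun (chartSymmDeriv_comp_frame hp) z
    -- In the product rule the divergence of the left-invariant field drops out by `htr`, leaving
    -- the derivative of the coefficient along it.
    rw [trace_fderiv_smul hH hd, htrF, htr, hfd, map_smul, map_smul, h4, density_eq hg hp,
      smul_eq_mul, hep]
    ring
  have hdiv : divergence g X p = (density g p (e p))⁻¹ * LinearMap.trace ℝ E
      (fderiv ℝ (fun x ↦ density g p x • mpullback 𝓘(ℝ, E) 𝓘(ℝ, E) e.symm X x) (e p) :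
        E →L[ℝ] E) := rfl
  rw [hdiv, hY.fderiv_eq, fderiv_fun_add (key h₁ a hh₁).1 (key h₂ b hh₂).1,
    ContinuousLinearMap.toLinearMap_add, map_add, (key h₁ a hh₁).2, (key h₂ b hh₂).2]
  ring

end LeftInvariant

/-! ### Chain rules -/

section ModelDeriv

variable {E : Type*} [NormedAddCommGroup E] [NormedSpace ℝ E]
  {M : Type*} [TopologicalSpace M] [ChartedSpace E M]
  {F F' : Type*} [NormedAddCommGroup F] [NormedSpace ℝ F] [NormedAddCommGroup F'] [NormedSpace ℝ F']

theorem modelDeriv_comp {φ : M → F} {f : F → F'} {p : M} (hf : DifferentiableAt ℝ f (φ p))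
    (hφ : MDifferentiableAt 𝓘(ℝ, E) 𝓘(ℝ, F) φ p) :
    modelDeriv (fun q ↦ f (φ q)) p = fderiv ℝ f (φ p) ∘L (modelDeriv φ p : E →L[ℝ] F) := by
  have h := mfderiv_comp p hf.mdifferentiableAt hφ
  rw [mfderiv_eq_fderiv] at h
  exact h

theorem modelDeriv_clm_comp {φ : M → F} (L : F →L[ℝ] F') {p : M}
    (hφ : MDifferentiableAt 𝓘(ℝ, E) 𝓘(ℝ, F) φ p) :
    modelDeriv (fun q ↦ L (φ q)) p = L ∘L (modelDeriv φ p : E →L[ℝ] F) := by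
  rw [modelDeriv_comp L.differentiableAt hφ, L.fderiv]

end ModelDeriv

/-! ### Laplacian and gradient of functions of a homomorphism -/

section Homomorphism

variable {E : Type*} [NormedAddCommGroup E] [NormedSpace ℝ E]
  {G : Type*} [TopologicalSpace G] [ChartedSpace E G] [Group G] [LieGroup 𝓘(ℝ, E) ∞ G]
  {F : Type*} [NormedAddCommGroup F]

theorem modelDeriv_comp_mul_left [NormedSpace ℝ F] {f : G → F} (hf : MDifferentiable 𝓘(ℝ, E) 𝓘(ℝ, F) f) (q : G)
    (v : E) : modelDeriv (fun x ↦ f (q * x)) 1 v = modelDeriv f q (mulLeftDeriv q 1 v) := by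
  have h := mfderiv_comp (I := 𝓘(ℝ, E)) (I' := 𝓘(ℝ, E)) (I'' := 𝓘(ℝ, F)) (1 : G) (hf (q * 1))
    (mdifferentiableAt_mul_left q 1)
  have h2 : ∀ c, q * 1 = c →
      modelDeriv (fun x ↦ f (q * x)) 1 v = modelDeriv f c (mulLeftDeriv q 1 v) := by
    rintro c rfl
    exact DFunLike.congr_fun h v
  exact h2 q (mul_one q)

/-- $\Phi\circ L_q$ differs from $\Phi$ by the constant $\Phi(q)$; thus the differential of $\Phi$
is constant in the left-invariant frame. -/
theorem modelDeriv_mulLeftDeriv [NormedSpace ℝ F] {Φ : G → F} (hΦ : MDifferentiable 𝓘(ℝ, E) 𝓘(ℝ, F) Φ)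
    (hmul : ∀ a b, Φ (a * b) = Φ a + Φ b) (q : G) (v : E) :
    modelDeriv Φ q (mulLeftDeriv q 1 v) = modelDeriv Φ 1 v := by
  rw [← modelDeriv_comp_mul_left hΦ]
  have h2 : (fun x ↦ Φ (q * x)) = fun x ↦ Φ q + Φ x := funext fun x ↦ hmul q x
  rw [h2]
  have h3 := modelDeriv_comp (f := fun y ↦ Φ q + y) (φ := Φ) (p := 1) (by fun_prop) (hΦ 1)
  rw [h3, fderiv_const_add]
  simp

variable [InnerProductSpace ℝ F] [FiniteDimensional ℝ E]

/-- The value at the identity of the gradient of the component of `Φ` along `u`. -/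
def componentGrad (g : Metric E G) (Φ : G → F) (u : F) : E := grad g (fun x ↦ inner ℝ u (Φ x)) 1

theorem innerAt_componentGrad (g : Metric E G) {Φ : G → F} (hΦ : MDifferentiable 𝓘(ℝ, E) 𝓘(ℝ, F) Φ)
    (u : F) (w : E) :
    innerAt g 1 (componentGrad g Φ u) w = inner ℝ u (modelDeriv Φ 1 w) := by
  have h1 : innerAt g 1 (componentGrad g Φ u) w =
    modelDeriv (fun x ↦ inner ℝ u (Φ x)) 1 w := inner_grad g _ 1 w
  have h2 := modelDeriv_clm_comp (innerSL ℝ u) (hΦ 1)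
  simp only [innerSL_apply_apply] at h2
  rw [h1, h2]
  simp

/-- Let $Tu$ be the image under $d\Phi_1$ of the gradient of $\langle u,\Phi\rangle$. Gradients are
horizontal, so the isometry property gives $\langle Tu,Tu'\rangle=\langle u,Tu'\rangle$. As $T$ is
injective on a finite-dimensional space it is onto, and $Tu=u$ follows. -/
theorem modelDeriv_componentGrad [FiniteDimensional ℝ F] {g : Metric E G} {Φ : G → F}
    (hΦ : IsRiemannianSubmersion g Φ) (u : F) : modelDeriv Φ 1 (componentGrad g Φ u) = u := by
  have hd : MDifferentiable 𝓘(ℝ, E) 𝓘(ℝ, F) Φ := hΦ.contMDiff.mdifferentiable (by simp)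
  have hsurj : Function.Surjective (modelDeriv Φ 1 : E →L[ℝ] F) := hΦ.surjective_mfderiv 1
  set T : F → F := fun u ↦ modelDeriv Φ 1 (componentGrad g Φ u)
  have hhor (u : F) (k : E) (hk : modelDeriv Φ 1 k = 0) : innerAt g 1 (componentGrad g Φ u) k = 0 := by
    rw [innerAt_componentGrad g hd, hk, inner_zero_right]
  have h1 (u u' : F) : inner ℝ (T u) (T u') = inner ℝ u (T u') := by
    refine Eq.trans ?_ (innerAt_componentGrad g hd u (componentGrad g Φ u'))
    exact hΦ.isometry_horizontal 1 (componentGrad (E := E) g Φ u)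
      (componentGrad (E := E) g Φ u') (hhor u) (hhor u')
  have hadd (u u' : F) : componentGrad g Φ (u + u') = componentGrad g Φ u + componentGrad g Φ u' := by
    refine grad_eq g fun w ↦ ?_
    have h2 := modelDeriv_clm_comp (innerSL ℝ (u + u')) (hd 1)
    simp only [innerSL_apply_apply] at h2
    rw [h2, ContinuousLinearMap.comp_apply, innerSL_apply_apply, inner_add_left,
      ← innerAt_componentGrad g hd, ← innerAt_componentGrad g hd]
    exact DFunLike.congr_fun ((g.inner 1).map_add _ _) _
  have hsmul (c : ℝ) (u : F) : componentGrad g Φ (c • u) = c • componentGrad g Φ u := by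
    refine grad_eq g fun w ↦ ?_
    have h2 := modelDeriv_clm_comp (innerSL ℝ (c • u)) (hd 1)
    simp only [innerSL_apply_apply] at h2
    rw [h2, ContinuousLinearMap.comp_apply, innerSL_apply_apply, real_inner_smul_left,
      ← innerAt_componentGrad g hd]
    exact DFunLike.congr_fun ((g.inner 1).map_smul c _) _
  let T' : F →ₗ[ℝ] F :=
    { toFun := T
      map_add' := fun u u' ↦ by simp only [T, hadd, map_add]
      map_smul' := fun c u ↦ by simp only [T, hsmul, map_smul, RingHom.id_apply] }
  have hinj : Function.Injective T' := by
    rw [injective_iff_map_eq_zero]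
    intro u hu
    have hu' : T u = 0 := hu
    obtain ⟨w, hw⟩ := hsurj u
    -- If $Tu=0$, the squared length of the gradient is $\langle u,Tu\rangle=0$; pairing the zero
    -- gradient with a preimage `w` of `u` then gives $|u|^2=0$.
    have h3 : componentGrad g Φ u = 0 := by
      by_contra hne
      have h4 : 0 < innerAt g 1 (componentGrad g Φ u) (componentGrad g Φ u) := g.pos 1 _ hne
      rw [innerAt_componentGrad g hd] at h4
      exact h4.ne' (by change inner ℝ u (T u) = 0; rw [hu', inner_zero_right])
    have h5 := innerAt_componentGrad g hd u w
    rw [h3, hw] at h5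
    have h6 : innerAt g 1 0 w = 0 := DFunLike.congr_fun ((g.inner 1).map_zero) w
    rw [h6] at h5
    exact inner_self_eq_zero.1 h5.symm
  have hsurjT := LinearMap.injective_iff_surjective.1 hinj
  refine ext_inner_right ℝ fun w ↦ ?_
  obtain ⟨u', rfl⟩ := hsurjT w
  exact h1 u u'

theorem innerAt_componentGrad_componentGrad [FiniteDimensional ℝ F] {g : Metric E G} {Φ : G → F}
    (hΦ : IsRiemannianSubmersion g Φ) (u w : F) :
    innerAt g 1 (componentGrad g Φ u) (componentGrad g Φ w) = inner ℝ u w := by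
  rw [innerAt_componentGrad g (hΦ.contMDiff.mdifferentiable (by simp)), modelDeriv_componentGrad hΦ]

/-- The complex-valued function with real part `⟪a, Φ⟫` and imaginary part `⟪b, Φ⟫`. -/
def complexComponent (Φ : G → F) (a b : F) (x : G) : ℂ :=
  ↑(inner ℝ a (Φ x)) + ↑(inner ℝ b (Φ x)) * Complex.I

/-- The linear map whose composition with `Φ` is `complexComponent Φ a b`. -/
def complexForm (a b : F) : F →L[ℝ] ℂ :=
  (innerSL ℝ a).smulRight (1 : ℂ) + (innerSL ℝ b).smulRight Complex.I

omit [TopologicalSpace G] [ChartedSpace E G] [Group G] [LieGroup 𝓘(ℝ, E) ∞ G] [FiniteDimensional ℝ E] in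
theorem complexComponent_eq (Φ : G → F) (a b : F) (x : G) :
    complexComponent Φ a b x = complexForm a b (Φ x) := by
  simp [complexComponent, complexForm]

theorem grad_comp_complexComponent {g : Metric E G} (hg : IsLeftInvariant g) {Φ : G → F}
    (hΦ : MDifferentiable 𝓘(ℝ, E) 𝓘(ℝ, F) Φ) (hmul : ∀ a b, Φ (a * b) = Φ a + Φ b) (a b : F)
    {f : ℂ → ℝ} {q : G} (hf : DifferentiableAt ℝ f (complexComponent Φ a b q)) :
    grad g (fun x ↦ f (complexComponent Φ a b x)) q =
      (fderiv ℝ f (complexComponent Φ a b q) 1 • mulLeftDeriv q 1 (componentGrad g Φ a) +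
        fderiv ℝ f (complexComponent Φ a b q) Complex.I •
          mulLeftDeriv q 1 (componentGrad g Φ b) : E) := by
  refine grad_eq g fun w ↦ ?_
  obtain ⟨w', rfl⟩ : ∃ w', w = mulLeftDeriv q 1 w' :=
    ⟨mulLeftDeriv q⁻¹ q w, (DFunLike.congr_fun (mulLeftDeriv_comp_inv q) w).symm⟩
  simp only [complexComponent_eq] at hf ⊢
  have h1 := modelDeriv_comp (f := fun y ↦ f (complexForm a b y)) (φ := Φ) (p := q)
    (hf.comp _ (complexForm a b).differentiableAt) (hΦ q)
  have h2 : fderiv ℝ (fun y ↦ f (complexForm a b y)) (Φ q) =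
      fderiv ℝ f (complexForm a b (Φ q)) ∘L complexForm a b := by
    have := fderiv_comp (Φ q) hf (complexForm a b).differentiableAt
    rwa [(complexForm a b).fderiv] at this
  rw [← map_smul, ← map_smul, ← map_add, innerAt_mulLeftDeriv hg, h1, h2]
  simp only [ContinuousLinearMap.comp_apply]
  rw [modelDeriv_mulLeftDeriv hΦ hmul]
  have h3 (s t : ℝ) (x y : E) : innerAt g 1 (s • x + t • y) w' =
      s * innerAt g 1 x w' + t * innerAt g 1 y w' := by
    have : innerOne g (s • x + t • y) w' = s * innerOne g x w' + t * innerOne g y w' := by simp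
    exact this
  rw [h3, innerAt_componentGrad g hΦ, innerAt_componentGrad g hΦ]
  have h4 (v : F) : complexForm a b v = inner ℝ a v • (1 : ℂ) + inner ℝ b v • Complex.I := rfl
  rw [h4 (modelDeriv Φ 1 w'), map_add, map_smul, map_smul, smul_eq_mul, smul_eq_mul]
  ring

/-- The gradient is $f_xX_a+f_yX_b$, whose divergence is the sum of the derivatives of the
coefficients along these fields, and $d\Phi(X_u)=u$. The factor density$^{-1}\cdot$density is left
uncancelled: only the vanishing of the other factor is used later. -/
theorem laplacian_comp_complexComponent [CompleteSpace E] [FiniteDimensional ℝ F]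
    (htr : ∀ y : E, LinearMap.trace ℝ E (lieAd G y) = 0)
    {g : Metric E G} (hg : IsLeftInvariant g) {Φ : G → F} (hΦ : IsRiemannianSubmersion g Φ)
    (hmul : ∀ a b, Φ (a * b) = Φ a + Φ b) (a b : F)
    {f : ℂ → ℝ} {p : G} (hf : ContDiffAt ℝ 2 f (complexComponent Φ a b p)) :
    laplacian g (fun x ↦ f (complexComponent Φ a b x)) p =
      (density g p (extChartAt 𝓘(ℝ, E) p p))⁻¹ * density g p (extChartAt 𝓘(ℝ, E) p p) *
      (fderiv ℝ (fderiv ℝ f) (complexComponent Φ a b p) (complexForm a b a) 1 +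
        fderiv ℝ (fderiv ℝ f) (complexComponent Φ a b p) (complexForm a b b) Complex.I) := by
  have hd : MDifferentiable 𝓘(ℝ, E) 𝓘(ℝ, F) Φ := hΦ.contMDiff.mdifferentiable (by simp)
  have hev : ∀ᶠ z in 𝓝 (complexComponent Φ a b p), DifferentiableAt ℝ f z :=
    (hf.eventually (by simp)).mono fun z hz ↦ hz.differentiableAt (by simp)
  have hcont : ContinuousAt (complexComponent Φ a b) p := by
    simp only [funext (complexComponent_eq Φ a b)]
    exact (complexForm a b).continuous.continuousAt.comp (hd p).continuousAt
  have hgrad : ∀ᶠ q in 𝓝 p, grad g (fun x ↦ f (complexComponent Φ a b x)) q =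
      (fderiv ℝ f (complexComponent Φ a b q) 1 • mulLeftDeriv q 1 (componentGrad g Φ a) +
        fderiv ℝ f (complexComponent Φ a b q) Complex.I •
          mulLeftDeriv q 1 (componentGrad g Φ b) : E) :=
    (hcont.eventually hev).mono fun q hq ↦ grad_comp_complexComponent hg hd hmul a b hq
  have hf2 : DifferentiableAt ℝ (fderiv ℝ f) (complexComponent Φ a b p) :=
    (hf.fderiv_right (m := 1) (by norm_num)).differentiableAt (by simp)
  rw [complexComponent_eq] at hf2
  have hcoef (z : ℂ) :
      MDifferentiableAt 𝓘(ℝ, E) 𝓘(ℝ, ℝ) (fun q ↦ fderiv ℝ f (complexComponent Φ a b q) z) p ∧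
      ∀ u, modelDeriv (fun q ↦ fderiv ℝ f (complexComponent Φ a b q) z) p
        (mulLeftDeriv p 1 (componentGrad g Φ u)) =
        fderiv ℝ (fderiv ℝ f) (complexComponent Φ a b p) (complexForm a b u) z := by
    simp only [complexComponent_eq]
    have h1 : HasFDerivAt (fun y ↦ fderiv ℝ f (complexForm a b y) z)
        ((fderiv ℝ (fderiv ℝ f) (complexForm a b (Φ p)) ∘L complexForm a b).flip z) (Φ p) := by
      have := (hf2.hasFDerivAt.comp (Φ p) (complexForm a b).hasFDerivAt).clm_apply
        (hasFDerivAt_const z (Φ p))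
      simpa using this
    refine ⟨h1.differentiableAt.mdifferentiableAt.comp p (hd p), fun u ↦ ?_⟩
    rw [modelDeriv_comp h1.differentiableAt (hd p), h1.fderiv, ContinuousLinearMap.comp_apply,
      modelDeriv_mulLeftDeriv hd hmul, modelDeriv_componentGrad hΦ]
    rfl
  rw [laplacian, divergence_eq htr hg hgrad (hcoef 1).1 (hcoef Complex.I).1, (hcoef 1).2,
    (hcoef Complex.I).2]

theorem fderiv_fderiv_eq_zero_of_clm (L : ℂ →L[ℝ] ℝ) (z : ℂ) : fderiv ℝ (fderiv ℝ L) z = 0 := by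
  have : fderiv ℝ (L : ℂ → ℝ) = fun _ ↦ L := funext fun z ↦ L.fderiv
  rw [this]; simp

omit [Group G] [LieGroup 𝓘(ℝ, E) ∞ G] [FiniteDimensional ℝ E] in
theorem contMDiff_complexComponent {n : ℕ∞ω} {Φ : G → F} (hΦ : ContMDiff 𝓘(ℝ, E) 𝓘(ℝ, F) n Φ)
    (a b : F) : ContMDiff 𝓘(ℝ, E) 𝓘(ℝ, ℂ) n (complexComponent Φ a b) := by
  rw [funext (complexComponent_eq Φ a b)]
  exact (complexForm a b).contDiff.contMDiff.comp hΦ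

/-- The Laplacian formula applied to the real and imaginary parts on $\mathbb C$, whose second
derivatives are zero. -/
theorem tau_complexComponent [CompleteSpace E] [FiniteDimensional ℝ F]
    (htr : ∀ y : E, LinearMap.trace ℝ E (lieAd G y) = 0)
    {g : Metric E G} (hg : IsLeftInvariant g) {Φ : G → F} (hΦ : IsRiemannianSubmersion g Φ)
    (hmul : ∀ a b, Φ (a * b) = Φ a + Φ b) (a b : F) (p : G) :
    tau g (complexComponent Φ a b) p = 0 := by
  have h1 := laplacian_comp_complexComponent htr hg hΦ hmul a b (p := p)
    Complex.reCLM.contDiff.contDiffAt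
  have h2 := laplacian_comp_complexComponent htr hg hΦ hmul a b (p := p)
    Complex.imCLM.contDiff.contDiffAt
  simp only [fderiv_fderiv_eq_zero_of_clm, zero_apply, add_zero, mul_zero,
    Complex.reCLM_apply, Complex.imCLM_apply] at h1 h2
  rw [tau, h1, h2]
  simp

theorem grad_inner_comp {g : Metric E G} (hg : IsLeftInvariant g) {Φ : G → F}
    (hΦ : MDifferentiable 𝓘(ℝ, E) 𝓘(ℝ, F) Φ) (hmul : ∀ a b, Φ (a * b) = Φ a + Φ b) (u : F) (q : G) :
    grad g (fun x ↦ inner ℝ u (Φ x)) q = (mulLeftDeriv q 1 (componentGrad g Φ u) : E) := by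
  have h := grad_comp_complexComponent hg hΦ hmul u 0 (q := q) Complex.reCLM.differentiableAt
  simpa [complexComponent] using h

theorem kappa_complexComponent [FiniteDimensional ℝ F]
    {g : Metric E G} (hg : IsLeftInvariant g) {Φ : G → F} (hΦ : IsRiemannianSubmersion g Φ)
    (hmul : ∀ a b, Φ (a * b) = Φ a + Φ b) (a b c d : F) (p : G) :
    kappa g (complexComponent Φ a b) (complexComponent Φ c d) p =
      ((inner ℝ a c - inner ℝ b d : ℝ) : ℂ) +
        ((inner ℝ a d + inner ℝ b c : ℝ) : ℂ) * Complex.I := by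
  have hd : MDifferentiable 𝓘(ℝ, E) 𝓘(ℝ, F) Φ := hΦ.contMDiff.mdifferentiable (by simp)
  have hre (a b : F) : (fun q ↦ (complexComponent Φ a b q).re) = fun q ↦ inner ℝ a (Φ q) := by
    ext q; simp [complexComponent]
  have him (a b : F) : (fun q ↦ (complexComponent Φ a b q).im) = fun q ↦ inner ℝ b (Φ q) := by
    ext q; simp [complexComponent]
  have h (u v : F) : g.inner p (grad g (fun x ↦ inner ℝ u (Φ x)) p)
      (grad g (fun x ↦ inner ℝ v (Φ x)) p) = inner ℝ u v := by
    rw [← innerAt_componentGrad_componentGrad hΦ u v, ← innerAt_mulLeftDeriv hg p]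
    rw [grad_inner_comp hg hd hmul, grad_inner_comp hg hd hmul]
    rfl
  simp only [kappa, hre, him, h]

theorem isHarmonicMorphism_complexComponent [CompleteSpace E] [FiniteDimensional ℝ F]
    (htr : ∀ y : E, LinearMap.trace ℝ E (lieAd G y) = 0)
    {g : Metric E G} (hg : IsLeftInvariant g) {Φ : G → F} (hΦ : IsRiemannianSubmersion g Φ)
    (hmul : ∀ a b, Φ (a * b) = Φ a + Φ b) {a b : F} (hab : inner ℝ a b = 0)
    (hnorm : inner ℝ a a = inner ℝ b b) : IsHarmonicMorphism g (complexComponent Φ a b) := by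
  refine ⟨contMDiff_complexComponent hΦ.contMDiff a b, fun U f hU _ hf ↦ ⟨?_, fun p hp ↦ ?_⟩⟩
  · intro p hp
    exact ((hf _ hp).1.contMDiffAt.comp p
      ((contMDiff_complexComponent (hΦ.contMDiff.of_le (WithTop.coe_le_coe.2 le_top)) a b) p)).contMDiffWithinAt
  · have h1 := (hf _ hp).2.self_of_nhds
    rw [InnerProductSpace.laplacian_eq_iteratedFDeriv_complexPlane] at h1
    simp only [iteratedFDeriv_two_apply] at h1
    -- Orthogonality and equal lengths make the two directions $|a|^2\cdot1$ and $|a|^2\cdot i$, so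
    -- the second-order expression is $|a|^2$ times the Euclidean Laplacian.
    have h2 : complexForm a b a = inner ℝ a a • (1 : ℂ) := by
      simp [complexForm, real_inner_comm, hab]
    have h3 : complexForm a b b = inner ℝ a a • Complex.I := by
      have : complexForm a b b = inner ℝ a b • (1 : ℂ) + inner ℝ b b • Complex.I := rfl
      rw [this, hab, hnorm, zero_smul, zero_add]
    have h4 := laplacian_comp_complexComponent htr hg hΦ hmul a b (hf _ hp).1
    rw [h2, h3, map_smul, map_smul] at h4
    refine h4.trans ?_
    simp only [smul_apply, smul_eq_mul, ← mul_add]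
    simp only [Matrix.cons_val_zero, Matrix.cons_val_one, Pi.zero_apply] at h1
    rw [h1, mul_zero, mul_zero]

end Homomorphism

/-! ### The adjoint action of the group in the chart at the identity -/

section Adjoint

set_option linter.unusedSectionVars false

variable {E : Type*} [NormedAddCommGroup E] [NormedSpace ℝ E]
  {G : Type*} [TopologicalSpace G] [ChartedSpace E G] [Group G]

variable (E G) in
/-- The coordinates of the identity in its preferred chart. -/
def onePt : E := extChartAt 𝓘(ℝ, E) (1 : G) 1

/-- The coordinate expression of a self-map of `G` in the preferred chart at the identity. -/
def localExpr (f : G → G) (x : E) : E :=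
  extChartAt 𝓘(ℝ, E) (1 : G) (f ((extChartAt 𝓘(ℝ, E) (1 : G)).symm x))

/-- The differential at the identity of a self-map of `G` that fixes the identity. -/
def derivOne (f : G → G) : E →L[ℝ] E := fderiv ℝ (localExpr f) (onePt E G)

variable (E G) in
/-- The multiplication of `G` in the preferred chart at the identity. -/
def localMul (x : E × E) : E :=
  extChartAt 𝓘(ℝ, E) (1 : G)
    ((extChartAt 𝓘(ℝ, E) (1 : G)).symm x.1 * (extChartAt 𝓘(ℝ, E) (1 : G)).symm x.2)

variable (E G) in
/-- The conjugation action of `G` on itself, in the preferred chart at the identity. -/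
def localConj (x : E × E) : E :=
  extChartAt 𝓘(ℝ, E) (1 : G)
    ((extChartAt 𝓘(ℝ, E) (1 : G)).symm x.1 * (extChartAt 𝓘(ℝ, E) (1 : G)).symm x.2 *
      ((extChartAt 𝓘(ℝ, E) (1 : G)).symm x.1)⁻¹)

/-- The adjoint action of `G` on its Lie algebra. -/
def groupAd (a : G) : E →L[ℝ] E := derivOne fun b ↦ a * b * a⁻¹

theorem symm_onePt : (extChartAt 𝓘(ℝ, E) (1 : G)).symm (onePt E G) = 1 := extChartAt_to_inv 1

theorem onePt_mem_target : onePt E G ∈ (extChartAt 𝓘(ℝ, E) (1 : G)).target :=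
  mem_extChartAt_target 1

theorem target_mem_nhds_onePt : (extChartAt 𝓘(ℝ, E) (1 : G)).target ∈ 𝓝 (onePt E G) :=
  (isOpen_extChartAt_target (I := 𝓘(ℝ, E)) (1 : G)).mem_nhds onePt_mem_target

theorem continuousAt_symm_onePt :
    ContinuousAt (extChartAt 𝓘(ℝ, E) (1 : G)).symm (onePt E G) := continuousAt_extChartAt_symm 1

theorem localExpr_onePt {f : G → G} (hf : f 1 = 1) : localExpr f (onePt E G) = onePt E G := by
  rw [localExpr, symm_onePt, hf]; rfl

theorem derivOne_id : derivOne (id : G → G) = ContinuousLinearMap.id ℝ E := by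
  have h : localExpr (id : G → G) =ᶠ[𝓝 (onePt E G)] id := by
    filter_upwards [target_mem_nhds_onePt] with x hx
    exact (extChartAt 𝓘(ℝ, E) (1 : G)).right_inv hx
  rw [derivOne, h.fderiv_eq, fderiv_id]

theorem derivOne_const_one : derivOne (fun _ : G ↦ (1 : G)) = (0 : E →L[ℝ] E) := by
  have h : localExpr (fun _ : G ↦ (1 : G)) = fun _ : E ↦ onePt E G := rfl
  rw [derivOne, h, fderiv_const_apply]

variable [LieGroup 𝓘(ℝ, E) ∞ G]

theorem contMDiffAt_symm_onePt :
    ContMDiffAt 𝓘(ℝ, E) 𝓘(ℝ, E) ∞ (extChartAt 𝓘(ℝ, E) (1 : G)).symm (onePt E G) :=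
  (contMDiffOn_extChartAt_symm 1).contMDiffAt target_mem_nhds_onePt

theorem eventually_symm_mem_source {X : Type*} [TopologicalSpace X] {u : X → G} {x : X}
    (hu : ContinuousAt u x) (hux : u x = 1) :
    ∀ᶠ y in 𝓝 x, u y ∈ (extChartAt 𝓘(ℝ, E) (1 : G)).source := by
  refine hu.eventually ?_
  rw [hux]
  exact extChartAt_source_mem_nhds 1

theorem contDiffAt_chart_comp {F : Type*} [NormedAddCommGroup F] [NormedSpace ℝ F] {u : F → G}
    {x : F} (hu : ContMDiffAt 𝓘(ℝ, F) 𝓘(ℝ, E) ∞ u x) (hux : u x = 1) :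
    ContDiffAt ℝ ∞ (fun y ↦ extChartAt 𝓘(ℝ, E) (1 : G) (u y)) x :=
  ((contMDiffAt_extChartAt (I := 𝓘(ℝ, E)) (n := ∞)).comp_of_eq hu hux).contDiffAt

theorem contDiffAt_localExpr {f : G → G} (hf : ContMDiff 𝓘(ℝ, E) 𝓘(ℝ, E) ∞ f) (hf1 : f 1 = 1) :
    ContDiffAt ℝ ∞ (localExpr f) (onePt E G) :=
  contDiffAt_chart_comp (hf.contMDiffAt.comp _ contMDiffAt_symm_onePt)
    (by rw [symm_onePt, hf1])

theorem differentiableAt_localExpr {f : G → G} (hf : ContMDiff 𝓘(ℝ, E) 𝓘(ℝ, E) ∞ f)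
    (hf1 : f 1 = 1) : DifferentiableAt ℝ (localExpr f) (onePt E G) :=
  (contDiffAt_localExpr hf hf1).differentiableAt (by simp)

theorem contMDiffAt_symm_fst : ContMDiffAt 𝓘(ℝ, E × E) 𝓘(ℝ, E) ∞
    (fun x : E × E ↦ (extChartAt 𝓘(ℝ, E) (1 : G)).symm x.1) (onePt E G, onePt E G) :=
  ContMDiffAt.comp (g := (extChartAt 𝓘(ℝ, E) (1 : G)).symm) (f := Prod.fst) _
    contMDiffAt_symm_onePt contDiff_fst.contMDiff.contMDiffAt

theorem contMDiffAt_symm_snd : ContMDiffAt 𝓘(ℝ, E × E) 𝓘(ℝ, E) ∞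
    (fun x : E × E ↦ (extChartAt 𝓘(ℝ, E) (1 : G)).symm x.2) (onePt E G, onePt E G) :=
  ContMDiffAt.comp (g := (extChartAt 𝓘(ℝ, E) (1 : G)).symm) (f := Prod.snd) _
    contMDiffAt_symm_onePt contDiff_snd.contMDiff.contMDiffAt

theorem contDiffAt_localMul : ContDiffAt ℝ ∞ (localMul E G) (onePt E G, onePt E G) :=
  contDiffAt_chart_comp (contMDiffAt_symm_fst.mul contMDiffAt_symm_snd)
    (by simp only [symm_onePt, mul_one])

theorem contDiffAt_localConj : ContDiffAt ℝ ∞ (localConj E G) (onePt E G, onePt E G) :=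
  contDiffAt_chart_comp ((contMDiffAt_symm_fst.mul contMDiffAt_symm_snd).mul
    contMDiffAt_symm_fst.inv) (by simp only [symm_onePt, mul_one, inv_one])

/-- Chain rule at the identity. -/
theorem derivOne_comp {f h : G → G} (hf : ContMDiff 𝓘(ℝ, E) 𝓘(ℝ, E) ∞ f)
    (hh : ContMDiff 𝓘(ℝ, E) 𝓘(ℝ, E) ∞ h) (hf1 : f 1 = 1) (hh1 : h 1 = 1) :
    derivOne (fun b ↦ f (h b)) = (derivOne f : E →L[ℝ] E) ∘L derivOne h := by
  have h1 : localExpr (fun b ↦ f (h b)) =ᶠ[𝓝 (onePt E G)] localExpr f ∘ localExpr h := by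
    have hc : ContinuousAt (fun x ↦ h ((extChartAt 𝓘(ℝ, E) (1 : G)).symm x)) (onePt E G) :=
      hh.continuous.continuousAt.comp continuousAt_symm_onePt
    filter_upwards [eventually_symm_mem_source (E := E) hc (by rw [symm_onePt, hh1])] with x hx
    simp only [localExpr, Function.comp_apply, (extChartAt 𝓘(ℝ, E) (1 : G)).left_inv hx]
  have hfd := differentiableAt_localExpr hf hf1
  rw [← localExpr_onePt (E := E) hh1] at hfd
  rw [derivOne, h1.fderiv_eq, fderiv_comp _ hfd (differentiableAt_localExpr hh hh1),
    localExpr_onePt hh1]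
  rfl

theorem fderiv_localMul_snd (z : E) :
    fderiv ℝ (localMul E G) (onePt E G, onePt E G) (0, z) = z := by
  have hd := (contDiffAt_localMul (E := E) (G := G)).differentiableAt (by simp)
  have h1 := hd.hasFDerivAt.comp (onePt E G)
    ((hasFDerivAt_const (onePt E G) (onePt E G)).prodMk (hasFDerivAt_id (onePt E G)))
  have h2 : (localMul E G ∘ fun y ↦ (onePt E G, id y)) =ᶠ[𝓝 (onePt E G)] id := by
    filter_upwards [target_mem_nhds_onePt] with x hx
    simp only [localMul, Function.comp_apply, symm_onePt, one_mul, id]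
    exact (extChartAt 𝓘(ℝ, E) (1 : G)).right_inv hx
  have h3 := h1.unique ((hasFDerivAt_id (onePt E G)).congr_of_eventuallyEq h2)
  simpa using DFunLike.congr_fun h3 z

theorem fderiv_localMul_fst (z : E) :
    fderiv ℝ (localMul E G) (onePt E G, onePt E G) (z, 0) = z := by
  have hd := (contDiffAt_localMul (E := E) (G := G)).differentiableAt (by simp)
  have h1 := HasFDerivAt.comp (f := fun y ↦ (id y, onePt E G)) (onePt E G) hd.hasFDerivAt
    ((hasFDerivAt_id (onePt E G)).prodMk (hasFDerivAt_const (onePt E G) (onePt E G)))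
  have h2 : (localMul E G ∘ fun y ↦ (id y, onePt E G)) =ᶠ[𝓝 (onePt E G)] id := by
    filter_upwards [target_mem_nhds_onePt] with x hx
    simp only [localMul, Function.comp_apply, symm_onePt, mul_one, id]
    exact (extChartAt 𝓘(ℝ, E) (1 : G)).right_inv hx
  have h3 := h1.unique ((hasFDerivAt_id (onePt E G)).congr_of_eventuallyEq h2)
  simpa using DFunLike.congr_fun h3 z

/-- The differential at the identity of a product of maps is the sum of the differentials. -/
theorem derivOne_mul {f h : G → G} (hf : ContMDiff 𝓘(ℝ, E) 𝓘(ℝ, E) ∞ f)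
    (hh : ContMDiff 𝓘(ℝ, E) 𝓘(ℝ, E) ∞ h) (hf1 : f 1 = 1) (hh1 : h 1 = 1) :
    derivOne (fun b ↦ f b * h b) = (derivOne f + derivOne h : E →L[ℝ] E) := by
  have h1 : localExpr (fun b ↦ f b * h b) =ᶠ[𝓝 (onePt E G)]
      localMul E G ∘ fun x ↦ (localExpr f x, localExpr h x) := by
    have hc : ContinuousAt (fun x ↦ h ((extChartAt 𝓘(ℝ, E) (1 : G)).symm x)) (onePt E G) :=
      hh.continuous.continuousAt.comp continuousAt_symm_onePt
    have hc' : ContinuousAt (fun x ↦ f ((extChartAt 𝓘(ℝ, E) (1 : G)).symm x)) (onePt E G) :=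
      hf.continuous.continuousAt.comp continuousAt_symm_onePt
    filter_upwards [eventually_symm_mem_source (E := E) hc (by rw [symm_onePt, hh1]),
      eventually_symm_mem_source (E := E) hc' (by rw [symm_onePt, hf1])] with x hx hx'
    simp only [localExpr, localMul, Function.comp_apply,
      (extChartAt 𝓘(ℝ, E) (1 : G)).left_inv hx, (extChartAt 𝓘(ℝ, E) (1 : G)).left_inv hx']
  have hd := (contDiffAt_localMul (E := E) (G := G)).differentiableAt (by simp)
  have h2 := (differentiableAt_localExpr hf hf1).hasFDerivAt.prodMk
    (differentiableAt_localExpr hh hh1).hasFDerivAt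
  have h3 : HasFDerivAt (localMul E G) (fderiv ℝ (localMul E G) (onePt E G, onePt E G))
      (localExpr f (onePt E G), localExpr h (onePt E G)) := by
    rw [localExpr_onePt hf1, localExpr_onePt hh1]; exact hd.hasFDerivAt
  have h4 (u v : E) : fderiv ℝ (localMul E G) (onePt E G, onePt E G) (u, v) = u + v := by
    conv_lhs => rw [← Prod.fst_add_snd (u, v), map_add, fderiv_localMul_snd, fderiv_localMul_fst]
  ext z
  rw [derivOne, h1.fderiv_eq, (h3.comp (onePt E G) h2).fderiv, ContinuousLinearMap.comp_apply,
    ContinuousLinearMap.prod_apply, h4]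
  rfl

theorem contMDiff_conj (a : G) : ContMDiff 𝓘(ℝ, E) 𝓘(ℝ, E) ∞ fun b : G ↦ a * b * a⁻¹ :=
  (contMDiff_const.mul contMDiff_id).mul contMDiff_const

theorem contMDiff_commutator (a : G) :
    ContMDiff 𝓘(ℝ, E) 𝓘(ℝ, E) ∞ fun b : G ↦ a * b * a⁻¹ * b⁻¹ :=
  (contMDiff_conj a).mul contMDiff_id.inv

theorem groupAd_one : groupAd (1 : G) = ContinuousLinearMap.id ℝ E := by
  rw [groupAd, ← derivOne_id (G := G)]
  congr 1
  ext b
  simp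

theorem groupAd_mul (a b : G) : groupAd (a * b) = (groupAd a : E →L[ℝ] E) ∘L groupAd b := by
  rw [groupAd, groupAd, groupAd,
    ← derivOne_comp (contMDiff_conj a) (contMDiff_conj b) (by simp) (by simp)]
  congr 1
  ext c
  group

/-- The product of this commutator with $b$ is the conjugate of $b$, and differentials at the
identity add under products. -/
theorem derivOne_commutator (a : G) :
    derivOne (fun b ↦ a * b * a⁻¹ * b⁻¹) = (groupAd a - ContinuousLinearMap.id ℝ E : E →L[ℝ] E) := by
  have h := derivOne_mul (contMDiff_commutator (E := E) a) contMDiff_id (by simp) rfl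
  rw [derivOne_id] at h
  rw [groupAd, eq_sub_iff_add_eq, ← h]
  congr 1
  ext b
  simp

end Adjoint

/-! ### The derivative of the adjoint action is the bracket -/

section AdjointDerivative

set_option linter.unusedSectionVars false

variable {E : Type*} [NormedAddCommGroup E] [NormedSpace ℝ E]
  {G : Type*} [TopologicalSpace G] [ChartedSpace E G] [Group G] [LieGroup 𝓘(ℝ, E) ∞ G]

theorem chartSymmDeriv_onePt : chartSymmDeriv (1 : G) (onePt E G) = ContinuousLinearMap.id ℝ E := by
  have h := mfderivWithin_range_extChartAt_symm (I := 𝓘(ℝ, E)) (x := (1 : G))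
  simp only [modelWithCornersSelf_coe, range_id, mfderivWithin_univ] at h
  exact h

theorem frame_onePt : frame (1 : G) (onePt E G) = ContinuousLinearMap.id ℝ E := by
  rw [frame, chartSymmDeriv_onePt, symm_onePt, mulLeftDeriv_one_left,
    ContinuousLinearMap.inverse_id, ContinuousLinearMap.comp_id]

theorem fderiv_chart_mul_left {x : E} (hx : x ∈ (extChartAt 𝓘(ℝ, E) (1 : G)).target) :
    fderiv ℝ (fun y ↦ localMul E G (x, y)) (onePt E G) = frame (1 : G) x := by
  set e := extChartAt 𝓘(ℝ, E) (1 : G) with he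
  have h1 : MDifferentiableAt 𝓘(ℝ, E) 𝓘(ℝ, E) e.symm (onePt E G) :=
    contMDiffAt_symm_onePt.mdifferentiableAt (by simp)
  have h2 := mdifferentiableAt_mul_left (E := E) (e.symm x) (e.symm (onePt E G))
  have hs : e.symm x * e.symm (onePt E G) ∈ e.source := by
    rw [he, symm_onePt, mul_one]; exact e.map_target hx
  have h3 : MDifferentiableAt 𝓘(ℝ, E) 𝓘(ℝ, E) e (e.symm x * e.symm (onePt E G)) :=
    mdifferentiableAt_extChartAt (by rwa [← extChartAt_source 𝓘(ℝ, E)])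
  ext z
  have h4 := mfderiv_comp (onePt E G) h2 h1
  have h5 := mfderiv_comp (onePt E G) h3 (h2.comp _ h1)
  rw [h4] at h5
  have h6 : fderiv ℝ (fun y ↦ localMul E G (x, y)) (onePt E G) z =
      chartDeriv 1 (e.symm x * e.symm (onePt E G)) (mulLeftDeriv (e.symm x) (e.symm (onePt E G))
        (chartSymmDeriv (1 : G) (onePt E G) z)) := by
    rw [← mfderiv_eq_fderiv]
    exact DFunLike.congr_fun h5 z
  rw [h6, chartSymmDeriv_onePt, he, symm_onePt, mul_one, frame_eq hx]
  rfl

theorem eventually_differentiableAt_prod {m : E × E → E} {x₀ : E}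
    (hm : ContDiffAt ℝ ∞ m (x₀, x₀)) :
    ∀ᶠ x in 𝓝 x₀, DifferentiableAt ℝ m (x, x₀) ∧ DifferentiableAt ℝ m (x₀, x) := by
  have h1 : ∀ᶠ y in 𝓝 (x₀, x₀), DifferentiableAt ℝ m y :=
    ((hm.of_le (m := 1) (WithTop.coe_le_coe.2 le_top)).eventually (by simp)).mono
      fun y hy ↦ hy.differentiableAt (by simp)
  have h2 : Tendsto (fun x ↦ (x, x₀)) (𝓝 x₀) (𝓝 (x₀, x₀)) :=
    (by fun_prop : Continuous fun x : E ↦ (x, x₀)).tendsto x₀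
  have h3 : Tendsto (fun x ↦ (x₀, x)) (𝓝 x₀) (𝓝 (x₀, x₀)) :=
    (by fun_prop : Continuous fun x : E ↦ (x₀, x)).tendsto x₀
  exact (h2.eventually h1).and (h3.eventually h1)

theorem fderiv_prodMk_right {m : E × E → E} {x y : E} (hm : DifferentiableAt ℝ m (x, y)) :
    fderiv ℝ (fun z ↦ m (x, z)) y = fderiv ℝ m (x, y) ∘L ContinuousLinearMap.inr ℝ E E :=
  (HasFDerivAt.comp (f := fun z ↦ (x, z)) y hm.hasFDerivAt (hasFDerivAt_prodMk_right x y)).fderiv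

theorem fderiv_prodMk_left {m : E × E → E} {x y : E} (hm : DifferentiableAt ℝ m (x, y)) :
    fderiv ℝ (fun z ↦ m (z, y)) x = fderiv ℝ m (x, y) ∘L ContinuousLinearMap.inl ℝ E E :=
  (HasFDerivAt.comp (f := fun z ↦ (z, y)) x hm.hasFDerivAt (hasFDerivAt_prodMk_left x y)).fderiv

theorem frame_eventuallyEq : frame (1 : G) =ᶠ[𝓝 (onePt E G)]
    fun x ↦ fderiv ℝ (localMul E G) (x, onePt E G) ∘L ContinuousLinearMap.inr ℝ E E := by
  filter_upwards [target_mem_nhds_onePt,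
    eventually_differentiableAt_prod (contDiffAt_localMul (E := E) (G := G))] with x hx hd
  rw [← fderiv_chart_mul_left hx, fderiv_prodMk_right hd.1]

theorem groupAd_eventuallyEq :
    (fun x ↦ groupAd (E := E) ((extChartAt 𝓘(ℝ, E) (1 : G)).symm x)) =ᶠ[𝓝 (onePt E G)]
    fun x ↦ fderiv ℝ (localConj E G) (x, onePt E G) ∘L ContinuousLinearMap.inr ℝ E E := by
  filter_upwards [eventually_differentiableAt_prod (contDiffAt_localConj (E := E) (G := G))]
    with x hd
  rw [← fderiv_prodMk_right hd.1]
  rfl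

/-- From $xy=(xyx^{-1})x$: left translation by $x$ is conjugation followed by right translation.
Comparing derivatives with `frame_eventuallyEq` isolates the derivative of the adjoint action. -/
theorem frame_eventuallyEq_comp_groupAd : frame (1 : G) =ᶠ[𝓝 (onePt E G)]
    fun x ↦ (fderiv ℝ (localMul E G) (onePt E G, x) ∘L ContinuousLinearMap.inl ℝ E E) ∘L
      groupAd (E := E) ((extChartAt 𝓘(ℝ, E) (1 : G)).symm x) := by
  set e := extChartAt 𝓘(ℝ, E) (1 : G) with he
  filter_upwards [target_mem_nhds_onePt,
    eventually_differentiableAt_prod (contDiffAt_localMul (E := E) (G := G))] with x hx hd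
  rw [← fderiv_chart_mul_left hx, ← fderiv_prodMk_left hd.2]
  have h1 : (fun y ↦ localMul E G (x, y)) =ᶠ[𝓝 (onePt E G)]
      (fun z ↦ localMul E G (z, x)) ∘ localExpr fun b ↦ e.symm x * b * (e.symm x)⁻¹ := by
    have hc : ContinuousAt (fun y ↦ e.symm x * e.symm y * (e.symm x)⁻¹) (onePt E G) :=
      (contMDiff_conj (E := E) (e.symm x)).continuous.continuousAt.comp
        (f := e.symm) continuousAt_symm_onePt
    filter_upwards [eventually_symm_mem_source (E := E) hc (by rw [he, symm_onePt]; simp)]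
      with y hy
    simp only [localMul, localExpr, Function.comp_apply, ← he, e.left_inv hy]
    simp
  have h2 : localExpr (fun b ↦ e.symm x * b * (e.symm x)⁻¹) (onePt E G) = onePt E G :=
    localExpr_onePt (by simp)
  have h3 : DifferentiableAt ℝ (fun z ↦ localMul E G (z, x))
      (localExpr (fun b ↦ e.symm x * b * (e.symm x)⁻¹) (onePt E G)) := by
    rw [h2]
    exact DifferentiableAt.comp (f := fun z ↦ (z, x)) _ hd.2 (by fun_prop)
  rw [h1.fderiv_eq, fderiv_comp _ h3 (differentiableAt_localExpr (contMDiff_conj (E := E) _) (by simp)), h2]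
  rfl

/-- The derivative of the adjoint action of the group is the bracket. -/
theorem hasFDerivAt_groupAd [FiniteDimensional ℝ E] :
    ∃ D : E →L[ℝ] E →L[ℝ] E,
      HasFDerivAt (fun x ↦ groupAd (E := E) ((extChartAt 𝓘(ℝ, E) (1 : G)).symm x)) D (onePt E G) ∧
      ∀ v z, D v z = lieOp G v z := by
  set x₀ := onePt E G
  have hm := contDiffAt_localMul (E := E) (G := G)
  have hm2 : DifferentiableAt ℝ (fderiv ℝ (localMul E G)) (x₀, x₀) :=
    (hm.fderiv_right (m := 1) (WithTop.coe_le_coe.2 le_top)).differentiableAt (by simp)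
  have hc2 : DifferentiableAt ℝ (fderiv ℝ (localConj E G)) (x₀, x₀) :=
    ((contDiffAt_localConj (E := E) (G := G)).fderiv_right (m := 1)
      (WithTop.coe_le_coe.2 le_top)).differentiableAt (by simp)
  have hAd : DifferentiableAt ℝ (fun x ↦ groupAd (E := E) ((extChartAt 𝓘(ℝ, E) (1 : G)).symm x)) x₀ := by
    refine DifferentiableAt.congr_of_eventuallyEq ?_ groupAd_eventuallyEq
    exact (DifferentiableAt.comp (f := fun x ↦ (x, x₀)) x₀ hc2 (by fun_prop)).clm_comp
      (differentiableAt_const _)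
  have hF : HasFDerivAt (fun x ↦ fderiv ℝ (localMul E G) (x, x₀) ∘L ContinuousLinearMap.inr ℝ E E)
      _ x₀ := (HasFDerivAt.comp (f := fun x ↦ (x, x₀)) x₀ hm2.hasFDerivAt
        (hasFDerivAt_prodMk_left x₀ x₀)).clm_comp (hasFDerivAt_const _ _)
  have hR : HasFDerivAt (fun x ↦ fderiv ℝ (localMul E G) (x₀, x) ∘L ContinuousLinearMap.inl ℝ E E)
      _ x₀ := (HasFDerivAt.comp (f := fun x ↦ (x₀, x)) x₀ hm2.hasFDerivAt
        (hasFDerivAt_prodMk_right x₀ x₀)).clm_comp (hasFDerivAt_const _ _)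
  have h1 := (hF.congr_of_eventuallyEq frame_eventuallyEq).unique
    ((hR.clm_comp hAd.hasFDerivAt).congr_of_eventuallyEq frame_eventuallyEq_comp_groupAd)
  have h2 := (hF.congr_of_eventuallyEq frame_eventuallyEq).fderiv
  have h7 : groupAd (E := E) ((extChartAt 𝓘(ℝ, E) (1 : G)).symm x₀) =
      ContinuousLinearMap.id ℝ E := by
    rw [symm_onePt, groupAd_one]
  rw [h7] at h1
  refine ⟨_, hAd.hasFDerivAt, fun v z ↦ ?_⟩
  generalize fderiv ℝ (fun x ↦ groupAd (E := E) ((extChartAt 𝓘(ℝ, E) (1 : G)).symm x)) x₀ = D at h1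
  have h3 := fderiv_frame_sub (p := (1 : G)) onePt_mem_target v z
  have h4 := DFunLike.congr_fun (DFunLike.congr_fun h1 v) z
  -- Symmetry of the second derivative of multiplication identifies the right-translation term of
  -- `h1` with the term subtracted in the structure equation `h3`.
  have h5 : fderiv ℝ (fderiv ℝ (localMul E G)) (x₀, x₀) (0, v) (z, 0) =
      fderiv ℝ (fderiv ℝ (localMul E G)) (x₀, x₀) (z, 0) (0, v) :=
    hm.isSymmSndFDerivAt (by simp; exact WithTop.coe_le_coe.2 le_top) (0, v) (z, 0)
  have h6 (w : E) : fderiv ℝ (localMul E G) (x₀, x₀) (w, 0) = w := fderiv_localMul_fst w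
  rw [frame_onePt, h2] at h3
  simp [h6] at h3 h4
  rw [← h3, h4, h5]
  abel

end AdjointDerivative

/-! ### From a nilpotent group to nilpotent adjoint endomorphisms -/

section Nilpotent

variable {E : Type*} [NormedAddCommGroup E] [NormedSpace ℝ E]
  {G : Type*} [TopologicalSpace G] [ChartedSpace E G] [Group G]

variable (E G) in
/-- The ascending series of the Lie algebra defined by the adjoint action of the group. -/
def adCenter : ℕ → Submodule ℝ E
  | 0 => ⊥
  | i + 1 => ⨅ a : G, (adCenter i).comap
      ((groupAd a - ContinuousLinearMap.id ℝ E : E →L[ℝ] E) : E →ₗ[ℝ] E)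

theorem mem_adCenter_succ {i : ℕ} {y : E} :
    y ∈ adCenter E G (i + 1) ↔ ∀ a : G, groupAd a y - y ∈ adCenter E G i := by
  simp [adCenter, Submodule.mem_iInf]

variable [LieGroup 𝓘(ℝ, E) ∞ G]

/-- Commutators of $a$ with values of $f$ lie one step lower in the upper central series, and the
differential of $b\mapsto[a,f(b)]$ is $(\operatorname{Ad}_a-1)\circ df$. Taking $f$ to be the
identity map makes `adCenter` exhaust the Lie algebra. -/
theorem derivOne_mem_adCenter (i : ℕ) {f : G → G} (hf : ContMDiff 𝓘(ℝ, E) 𝓘(ℝ, E) ∞ f)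
    (hf1 : f 1 = 1) (h : ∀ b, f b ∈ Subgroup.upperCentralSeries G i) (y : E) :
    derivOne f y ∈ adCenter E G i := by
  induction i generalizing f with
  | zero =>
    have : f = fun _ ↦ 1 := funext fun b ↦ by simpa using h b
    rw [this, derivOne_const_one]
    exact Submodule.zero_mem _
  | succ i ih =>
    refine mem_adCenter_succ.2 fun a ↦ ?_
    have h1 := derivOne_comp (contMDiff_commutator (E := E) a) hf (by simp) hf1
    rw [derivOne_commutator] at h1
    have h2 := ih (f := fun b ↦ a * f b * a⁻¹ * (f b)⁻¹) ((contMDiff_commutator a).comp hf)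
      (by simp [hf1]) fun b ↦ ?_
    · rw [h1] at h2
      simpa using h2
    -- The membership criterion supplies the commutator with its arguments in the other order, which
    -- is the inverse.
    · have h3 := inv_mem (Subgroup.mem_upperCentralSeries_succ_iff.1 (h b) a)
      convert h3 using 1
      group

variable (E G) in
theorem exists_adCenter_eq_top [Group.IsNilpotent G] : ∃ n, adCenter E G n = ⊤ := by
  obtain ⟨n, hn⟩ := Group.IsNilpotent.nilpotent G
  refine ⟨n, eq_top_iff.2 fun y _ ↦ ?_⟩
  have h := derivOne_mem_adCenter (E := E) n (f := (id : G → G)) contMDiff_id rfl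
    (fun b ↦ by rw [hn]; trivial) y
  rwa [derivOne_id] at h

variable [FiniteDimensional ℝ E]

omit [LieGroup 𝓘(ℝ, E) ∞ G] [TopologicalSpace G] [ChartedSpace E G] [Group G] in
theorem hasDerivAt_mem_submodule {S : Submodule ℝ E} {f : ℝ → E} {f' : E} {t : ℝ}
    (hf : HasDerivAt f f' t) (hS : ∀ s, f s - f t ∈ S) : f' ∈ S :=
  (Submodule.closed_of_finiteDimensional S).mem_of_tendsto hf.tendsto_slope
    (Eventually.of_forall fun s ↦ by
      rw [slope_def_module]; exact Submodule.smul_mem _ _ (hS s))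

/-- $[v,y]$ is the derivative of $\operatorname{Ad}$ applied to $y$ along a curve with velocity $v$;
the increments lie in a subspace, which is closed by finite dimension. -/
theorem lieOp_mem_adCenter {i : ℕ} {y : E} (hy : y ∈ adCenter E G (i + 1)) (v : E) :
    lieOp G v y ∈ adCenter E G i := by
  obtain ⟨D, hD, hDv⟩ := hasFDerivAt_groupAd (E := E) (G := G)
  generalize (extChartAt 𝓘(ℝ, E) (1 : G)).symm = φ at hD
  rw [← hDv]
  have hline : HasDerivAt (fun t : ℝ ↦ onePt E G + t • v) v 0 := by
    simpa using ((hasDerivAt_id (0 : ℝ)).smul_const v).const_add (onePt E G)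
  have hD' : HasFDerivAt (fun x ↦ groupAd (E := E) (φ x)) D (onePt E G + (0 : ℝ) • v) := by
    rwa [zero_smul, add_zero]
  have h1 : HasDerivAt (fun t : ℝ ↦ groupAd (E := E) (φ (onePt E G + t • v))) (D v) 0 :=
    HasFDerivAt.comp_hasDerivAt (l := fun x ↦ groupAd (E := E) (φ x)) 0 hD' hline
  have h2 : HasDerivAt (fun t : ℝ ↦ groupAd (E := E) (φ (onePt E G + t • v)) y) (D v y) 0 := by
    simpa using h1.clm_apply (hasDerivAt_const (0 : ℝ) y)
  refine hasDerivAt_mem_submodule h2 fun s ↦ ?_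
  have h3 := Submodule.sub_mem _ (mem_adCenter_succ.1 hy (φ (onePt E G + s • v)))
    (mem_adCenter_succ.1 hy (φ (onePt E G + (0 : ℝ) • v)))
  rwa [sub_sub_sub_cancel_right] at h3

/-- The $i$-th power of $\operatorname{ad}_v$ kills the $i$-th term of the ascending series, so
$\operatorname{ad}_v$ is nilpotent. -/
theorem trace_lieAd [CompleteSpace E] [Group.IsNilpotent G] (v : E) :
    LinearMap.trace ℝ E (lieAd G v) = 0 := by
  obtain ⟨n, hn⟩ := exists_adCenter_eq_top E G
  refine (LinearMap.isNilpotent_trace_of_isNilpotent ⟨n, ?_⟩).eq_zero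
  have h (i : ℕ) : ∀ y ∈ adCenter E G i, (lieAd G v ^ i) y = 0 := by
    induction i with
    | zero => intro y hy; simpa [adCenter] using hy
    | succ i ih =>
      intro y hy
      rw [pow_succ, Module.End.mul_apply]
      exact ih _ (lieOp_mem_adCenter hy v)
  ext y
  exact h n y (by rw [hn]; trivial)

theorem lieOp_self (v : E) : lieOp G v v = 0 := by
  have : CompleteSpace E := FiniteDimensional.complete ℝ E
  have := lieGroup_minSmoothness (E := E) (G := G)
  exact lie_self (L := GroupLieAlgebra 𝓘(ℝ, E) G) v

theorem lieOp_add_left (u v w : E) : lieOp G (u + v) w = lieOp G u w + lieOp G v w := by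
  have : CompleteSpace E := FiniteDimensional.complete ℝ E
  have := lieGroup_minSmoothness (E := E) (G := G)
  exact add_lie (L := GroupLieAlgebra 𝓘(ℝ, E) G) (M := GroupLieAlgebra 𝓘(ℝ, E) G) u v w

theorem lieOp_smul_left (c : ℝ) (v w : E) : lieOp G (c • v) w = c • lieOp G v w := by
  have : CompleteSpace E := FiniteDimensional.complete ℝ E
  have := lieGroup_minSmoothness (E := E) (G := G)
  exact smul_lie (L := GroupLieAlgebra 𝓘(ℝ, E) G) (M := GroupLieAlgebra 𝓘(ℝ, E) G) c v w

theorem lieOp_skew (u v : E) : lieOp G u v = -lieOp G v u := by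
  have : CompleteSpace E := FiniteDimensional.complete ℝ E
  have := lieGroup_minSmoothness (E := E) (G := G)
  exact (lie_skew (L := GroupLieAlgebra 𝓘(ℝ, E) G) u v).symm

theorem lieOp_add_right (u v w : E) : lieOp G u (v + w) = lieOp G u v + lieOp G u w := by
  have : CompleteSpace E := FiniteDimensional.complete ℝ E
  exact (lieAd G u).map_add v w

theorem lieOp_smul_right (c : ℝ) (u v : E) : lieOp G u (c • v) = c • lieOp G u v := by
  have : CompleteSpace E := FiniteDimensional.complete ℝ E
  exact (lieAd G u).map_smul c v

/-- If a nilpotent Lie algebra is spanned by one element modulo its derived algebra, then it is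
abelian. -/
theorem lieOp_eq_zero_of_span [Group.IsNilpotent G] {D : Submodule ℝ E}
    (hD : D = Submodule.span ℝ {z | ∃ x y : E, z = lieOp G x y}) {x : E}
    (hx : ∀ y : E, ∃ c : ℝ, y - c • x ∈ D) (u v : E) : lieOp G u v = 0 := by
  obtain ⟨n, hn⟩ := exists_adCenter_eq_top E G
  -- Descent: once the derived algebra lies in term $i+1$, it lies in term $i$, since every bracket
  -- can be rewritten with one entry in the derived algebra. At $i=0$ the term is zero.
  have key (k : ℕ) : ∀ i, n ≤ i + k → D ≤ adCenter E G i := by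
    induction k with
    | zero =>
      intro i hi
      have h1 (j : ℕ) : adCenter E G (n + j) = ⊤ := by
        induction j with
        | zero => exact hn
        | succ j ih =>
          refine eq_top_iff.2 fun y _ ↦ mem_adCenter_succ.2 fun a ↦ ?_
          change _ ∈ adCenter E G (n + j)
          rw [ih]
          trivial
      obtain ⟨j, rfl⟩ := Nat.exists_eq_add_of_le (by simpa using hi : n ≤ i)
      rw [h1]; exact le_top
    | succ k ih =>
      intro i hi
      have hi' := ih (i + 1) (by omega)
      have hr (u : E) {d : E} (hd : d ∈ D) : lieOp G u d ∈ adCenter E G i :=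
        lieOp_mem_adCenter (hi' hd) u
      have hl {d : E} (hd : d ∈ D) (u : E) : lieOp G d u ∈ adCenter E G i := by
        rw [lieOp_skew]; exact Submodule.neg_mem _ (hr u hd)
      conv_lhs => rw [hD]
      rw [Submodule.span_le]
      rintro z ⟨y₁, y₂, rfl⟩
      obtain ⟨c₁, h₁⟩ := hx y₁
      obtain ⟨c₂, h₂⟩ := hx y₂
      -- Subtracting multiples of `x` moves each entry into `D`; the leftover bracket of `x` with
      -- itself is zero.
      have h3 : lieOp G y₁ y₂ = lieOp G y₁ (y₂ - c₂ • x) + c₂ • lieOp G (y₁ - c₁ • x) x := by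
        have h4 : lieOp G y₁ y₂ = lieOp G y₁ (y₂ - c₂ • x) + c₂ • lieOp G y₁ x := by
          rw [← lieOp_smul_right, ← lieOp_add_right, sub_add_cancel]
        have h5 : lieOp G y₁ x = lieOp G (y₁ - c₁ • x) x := by
          have := lieOp_add_left (G := G) (y₁ - c₁ • x) (c₁ • x) x
          rwa [sub_add_cancel, lieOp_smul_left, lieOp_self, smul_zero, add_zero] at this
        rw [h4, h5]
      rw [h3]
      exact Submodule.add_mem _ (hr _ h₂) (Submodule.smul_mem _ _ (hl h₁ _))
  have h := key n 0 (by omega) (show lieOp G u v ∈ D by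
    rw [hD]; exact Submodule.subset_span ⟨u, v, rfl⟩)
  simpa [adCenter] using h

end Nilpotent

/-! ### Maps with vanishing differential -/

section LocallyConstant

variable {E E' : Type*} [NormedAddCommGroup E] [NormedSpace ℝ E] [NormedAddCommGroup E']
  [NormedSpace ℝ E']
  {M : Type*} [TopologicalSpace M] [ChartedSpace E M] [IsManifold 𝓘(ℝ, E) 1 M]
  {M' : Type*} [TopologicalSpace M'] [ChartedSpace E' M'] [IsManifold 𝓘(ℝ, E') 1 M']

/-- A map whose differential vanishes near a point is constant near this point. -/
theorem eventually_eq_of_mfderiv_eq_zero {f : M → M'} {p : M}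
    (hf : ∀ᶠ q in 𝓝 p, MDifferentiableAt 𝓘(ℝ, E) 𝓘(ℝ, E') f q ∧
      mfderiv 𝓘(ℝ, E) 𝓘(ℝ, E') f q = 0) : ∀ᶠ q in 𝓝 p, f q = f p := by
  set e := extChartAt 𝓘(ℝ, E) p
  set e' := extChartAt 𝓘(ℝ, E') (f p)
  have hep : e.symm (e p) = p := extChartAt_to_inv p
  have hs : ContinuousAt e.symm (e p) := continuousAt_extChartAt_symm p
  have h1 : ∀ᶠ q in 𝓝 p, f q ∈ e'.source :=
    hf.self_of_nhds.1.continuousAt.eventually (extChartAt_source_mem_nhds (f p))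
  have h2 : ∀ᶠ x in 𝓝 (e p), x ∈ e.target ∧ f (e.symm x) ∈ e'.source ∧
      MDifferentiableAt 𝓘(ℝ, E) 𝓘(ℝ, E') f (e.symm x) ∧
      mfderiv 𝓘(ℝ, E) 𝓘(ℝ, E') f (e.symm x) = 0 := by
    have h3 : Tendsto e.symm (𝓝 (e p)) (𝓝 p) := by simpa only [ContinuousAt, hep] using hs
    have ht : ∀ᶠ x in 𝓝 (e p), x ∈ e.target := extChartAt_target_mem_nhds p
    exact ht.and ((h3.eventually h1).and (h3.eventually hf))
  obtain ⟨r, hr, hball⟩ := Metric.eventually_nhds_iff_ball.1 h2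
  have h4 (x : E) (hx : x ∈ Metric.ball (e p) r) :
      HasFDerivAt (fun y ↦ e' (f (e.symm y))) (0 : E →L[ℝ] E') x := by
    obtain ⟨hxt, hxs, hd, h0⟩ := hball x hx
    have hd1 : MDifferentiableAt 𝓘(ℝ, E) 𝓘(ℝ, E) e.symm x :=
      ((contMDiffOn_extChartAt_symm (n := 1) p).contMDiffAt
        ((isOpen_extChartAt_target (I := 𝓘(ℝ, E)) p).mem_nhds hxt)).mdifferentiableAt (by simp)
    have hd2 : MDifferentiableAt 𝓘(ℝ, E') 𝓘(ℝ, E') e' (f (e.symm x)) :=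
      mdifferentiableAt_extChartAt (by rwa [← extChartAt_source 𝓘(ℝ, E')])
    have h5 := (hd.hasMFDerivAt.comp x hd1.hasMFDerivAt)
    rw [h0] at h5
    have h6 := (hd2.hasMFDerivAt.comp x h5).hasFDerivAt
    have h7 : (fun y ↦ e' (f (e.symm y))) = e' ∘ f ∘ e.symm := rfl
    rw [h7]
    refine h6.congr_fderiv ?_
    ext v
    exact map_zero (mfderiv 𝓘(ℝ, E') 𝓘(ℝ, E') e' (f (e.symm x)))
  have h8 (x : E) (hx : x ∈ Metric.ball (e p) r) : f (e.symm x) = f p := by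
    have h9 := (convex_ball (e p) r).is_const_of_fderivWithin_eq_zero (𝕜 := ℝ)
      (fun y hy ↦ (h4 y hy).differentiableAt.differentiableWithinAt)
      (fun y hy ↦ by
        rw [fderivWithin_of_isOpen Metric.isOpen_ball hy, (h4 y hy).fderiv])
      hx (Metric.mem_ball_self hr)
    -- The ball was chosen so that `f` maps it into one chart domain of the target, where equal
    -- coordinates mean equal points.
    have h10 := e'.injOn (hball x hx).2.1 (hball _ (Metric.mem_ball_self hr)).2.1 h9
    rwa [hep] at h10
  have h11 : ∀ᶠ q in 𝓝 p, e q ∈ Metric.ball (e p) r :=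
    (continuousAt_extChartAt p).eventually (Metric.ball_mem_nhds _ hr)
  filter_upwards [h11, extChartAt_source_mem_nhds (I := 𝓘(ℝ, E)) p] with q hq hqs
  rw [← h8 _ hq, e.left_inv hqs]

theorem eq_of_mfderiv_eq_zero [PreconnectedSpace M] {f : M → M'}
    (hf : MDifferentiable 𝓘(ℝ, E) 𝓘(ℝ, E') f) (h0 : ∀ q, mfderiv 𝓘(ℝ, E) 𝓘(ℝ, E') f q = 0)
    (x y : M) : f x = f y := by
  have h : IsLocallyConstant f := (IsLocallyConstant.iff_eventually_eq f).2 fun p ↦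
    eventually_eq_of_mfderiv_eq_zero (Eventually.of_forall fun q ↦ ⟨hf q, h0 q⟩)
  exact h.apply_eq_of_isPreconnected isPreconnected_univ (mem_univ x) (mem_univ y)

end LocallyConstant

/-! ### Abelian Lie algebra, commutative group, and the bound on the abelianization -/

section Abelian

set_option linter.unusedSectionVars false

variable {E : Type*} [NormedAddCommGroup E] [NormedSpace ℝ E]
  {G : Type*} [TopologicalSpace G] [ChartedSpace E G] [Group G] [LieGroup 𝓘(ℝ, E) ∞ G]

theorem isManifold_one_of_lieGroup : IsManifold 𝓘(ℝ, E) 1 G :=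
  .of_le (n := ∞) (WithTop.coe_le_coe.2 le_top)

theorem mfderiv_eq_derivOne {f : G → G} (hf : ContMDiff 𝓘(ℝ, E) 𝓘(ℝ, E) ∞ f) (hf1 : f 1 = 1)
    (v : E) : (mfderiv 𝓘(ℝ, E) 𝓘(ℝ, E) f 1 : E →L[ℝ] E) v = derivOne f v := by
  have h : (mfderiv 𝓘(ℝ, E) 𝓘(ℝ, E) f 1 : E →L[ℝ] E) =
      fderivWithin ℝ (fun x ↦ extChartAt 𝓘(ℝ, E) (f 1) (f ((extChartAt 𝓘(ℝ, E) (1 : G)).symm x)))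
        (range 𝓘(ℝ, E)) (extChartAt 𝓘(ℝ, E) (1 : G) 1) :=
    (hf.mdifferentiable (by simp) 1).mfderiv
  rw [h, hf1, modelWithCornersSelf_coe, range_id, fderivWithin_univ]
  rfl

variable [FiniteDimensional ℝ E]

/-- If the Lie algebra is abelian, the adjoint action of a connected group is trivial. -/
theorem groupAd_eq_id [PreconnectedSpace G] (h : ∀ u v : E, lieOp G u v = 0) (a : G) :
    groupAd a = ContinuousLinearMap.id ℝ E := by
  have := isManifold_one_of_lieGroup (E := E) (G := G)
  obtain ⟨D, hD, hDv⟩ := hasFDerivAt_groupAd (E := E) (G := G)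
  have hD0 : D = 0 := by ext u v; rw [hDv, h]; rfl
  have h1 : HasMFDerivAt 𝓘(ℝ, E) 𝓘(ℝ, E →L[ℝ] E) (groupAd : G → E →L[ℝ] E) 1 0 := by
    have h2 := hD.hasMFDerivAt
    have h3 := (mdifferentiableAt_extChartAt (I := 𝓘(ℝ, E)) (x := (1 : G))
      (mem_chart_source E (1 : G))).hasMFDerivAt
    have h4 := h2.comp (1 : G) h3
    have h5 : (groupAd : G → E →L[ℝ] E) =ᶠ[𝓝 1]
        (fun x ↦ groupAd (E := E) ((extChartAt 𝓘(ℝ, E) (1 : G)).symm x)) ∘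
          extChartAt 𝓘(ℝ, E) (1 : G) := by
      filter_upwards [extChartAt_source_mem_nhds (I := 𝓘(ℝ, E)) (1 : G)] with q hq
      simp only [Function.comp_apply, (extChartAt 𝓘(ℝ, E) (1 : G)).left_inv hq]
    have h6 := h4.congr_of_eventuallyEq h5
    rw [hD0] at h6
    exact h6
  have h7 (b : G) : HasMFDerivAt 𝓘(ℝ, E) 𝓘(ℝ, E →L[ℝ] E) (groupAd : G → E →L[ℝ] E) b 0 := by
    -- Multiplicativity of $\operatorname{Ad}$ carries the vanishing of its derivative from the
    -- identity to $b$.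
    have h8 : (groupAd : G → E →L[ℝ] E) =
        (fun T : E →L[ℝ] E ↦ groupAd b ∘L T) ∘ groupAd ∘ (b⁻¹ * ·) := by
      ext c v
      have := groupAd_mul (E := E) b (b⁻¹ * c)
      rw [mul_inv_cancel_left] at this
      rw [this]; rfl
    have h9 : HasMFDerivAt 𝓘(ℝ, E) 𝓘(ℝ, E →L[ℝ] E) (groupAd : G → E →L[ℝ] E) (b⁻¹ * b) 0 := by
      rwa [inv_mul_cancel]
    have h10 := h9.comp b (mdifferentiableAt_mul_left (E := E) b⁻¹ b).hasMFDerivAt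
    have h11 := (ContinuousLinearMap.compL ℝ E E E (groupAd b)).hasFDerivAt.hasMFDerivAt.comp b h10
    rw [h8]
    convert! h11 using 1
    ext v
    exact (map_zero (ContinuousLinearMap.compL ℝ E E E (groupAd b))).symm
  rw [eq_of_mfderiv_eq_zero (fun b ↦ (h7 b).mdifferentiableAt) (fun b ↦ (h7 b).mfderiv) a 1,
    groupAd_one]

/-- A connected Lie group with abelian Lie algebra is commutative. -/
theorem mul_comm_of_lieOp_eq_zero [PreconnectedSpace G] (h : ∀ u v : E, lieOp G u v = 0) (a b : G) :
    a * b = b * a := by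
  have := isManifold_one_of_lieGroup (E := E) (G := G)
  set f : G → G := fun b ↦ a * b * a⁻¹ * b⁻¹ with hf
  have hfs : ContMDiff 𝓘(ℝ, E) 𝓘(ℝ, E) ∞ f := contMDiff_commutator a
  have h1 : HasMFDerivAt 𝓘(ℝ, E) 𝓘(ℝ, E) f 1 0 := by
    have h2 := (hfs.mdifferentiable (by simp) 1).hasMFDerivAt
    convert! h2 using 1
    ext v
    have h3 := mfderiv_eq_derivOne hfs (by simp [hf]) v
    rw [hf, derivOne_commutator, groupAd_eq_id h, sub_self] at h3
    exact h3.symm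
  have h4 (c : G) : HasMFDerivAt 𝓘(ℝ, E) 𝓘(ℝ, E) f c 0 := by
    -- The commutator at $x$ is recovered from the one at $c^{-1}x$ by fixed left and right
    -- translations, which carries the vanishing of the derivative to $c$.
    have h5 : f = (fun x ↦ a * c * a⁻¹ * x * c⁻¹) ∘ f ∘ (c⁻¹ * ·) := by
      ext x
      simp only [hf, Function.comp_apply]
      group
    have h6 : HasMFDerivAt 𝓘(ℝ, E) 𝓘(ℝ, E) f (c⁻¹ * c) 0 := by rwa [inv_mul_cancel]
    have h7 := h6.comp c (mdifferentiableAt_mul_left (E := E) c⁻¹ c).hasMFDerivAt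
    have h8 : ContMDiff 𝓘(ℝ, E) 𝓘(ℝ, E) ∞ fun x : G ↦ a * c * a⁻¹ * x * c⁻¹ :=
      (contMDiff_const.mul contMDiff_id).mul contMDiff_const
    have h9 := (h8.mdifferentiable (by simp) _).hasMFDerivAt.comp c h7
    rw [h5]
    convert! h9 using 1
    ext v
    exact (map_zero (mfderiv 𝓘(ℝ, E) 𝓘(ℝ, E) (fun x : G ↦ a * c * a⁻¹ * x * c⁻¹) _)).symm
  have h10 := eq_of_mfderiv_eq_zero (fun c ↦ (h4 c).mdifferentiableAt) (fun c ↦ (h4 c).mfderiv) b 1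
  simp only [hf, mul_one, mul_inv_cancel, inv_one] at h10
  exact mul_inv_eq_iff_eq_mul.1 (mul_inv_eq_one.1 h10)

/-- The abelianization of the Lie algebra of a non-commutative connected nilpotent Lie group has
dimension at least two. -/
theorem two_le_finrank_quotient_derivedAlgebra [PreconnectedSpace G] [Group.IsNilpotent G]
    (hG : ¬ ∀ a b : G, a * b = b * a) :
    2 ≤ Module.finrank ℝ (GroupLieAlgebra 𝓘(ℝ, E) G ⧸ derivedAlgebra E G) := by
  by_contra hlt
  have : FiniteDimensional ℝ (GroupLieAlgebra 𝓘(ℝ, E) G) := inferInstanceAs (FiniteDimensional ℝ E)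
  obtain ⟨w, hw⟩ := finrank_le_one_iff.1 (by omega :
    Module.finrank ℝ (GroupLieAlgebra 𝓘(ℝ, E) G ⧸ derivedAlgebra E G) ≤ 1)
  obtain ⟨x, rfl⟩ := (derivedAlgebra E G).mkQ_surjective w
  let D : Submodule ℝ E := derivedAlgebra E G
  let x' : E := x
  refine hG (mul_comm_of_lieOp_eq_zero (lieOp_eq_zero_of_span (D := D) rfl (x := x') fun y ↦ ?_))
  obtain ⟨c, hc⟩ := hw ((derivedAlgebra E G).mkQ y)
  refine ⟨c, ?_⟩
  rw [← map_smul] at hc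
  exact (Submodule.Quotient.eq _).1 hc.symm

end Abelian

/-! ### Gluing local primitives over a simply connected space -/

section Gluing

/-- On a simply connected space, functions given on the members of an open cover whose differences
are locally constant come from a global function, up to locally constant functions. -/
theorem exists_glue {M F : Type*} [TopologicalSpace M] [SimplyConnectedSpace M]
    [LocallyPathConnectedSpace M] [AddCommGroup F] (f : M → M → F) (U : M → Set M)
    (hU : ∀ i, IsOpen (U i)) (hmem : ∀ i, i ∈ U i)
    (hf : ∀ i j, ∀ x ∈ U i ∩ U j, ∀ᶠ y in 𝓝 x, f i y - f j y = f i x - f j x) :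
    ∃ Φ : M → F, ∀ i, ∀ x ∈ U i, ∀ᶠ y in 𝓝 x, Φ y - f i y = Φ x - f i x := by
  -- With `F` discrete, the transition maps are continuous exactly because the differences $f_i-f_j$
  -- are locally constant. The coordinate $v$ in chart $i$ stands for a primitive with value
  -- $v+f_i(x)$ at $x$.
  let τ : TopologicalSpace F := ⊥
  have hτ : DiscreteTopology F := ⟨rfl⟩
  let Z : FiberBundleCore M M F :=
    { baseSet := U
      isOpen_baseSet := hU
      indexAt := id
      mem_baseSet_at := hmem
      coordChange := fun i j x v ↦ v + f i x - f j x
      coordChange_self := fun i x _ v ↦ by abel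
      continuousOn_coordChange := fun i j ↦ by
        rintro ⟨x, v⟩ ⟨hx, -⟩
        refine ContinuousAt.continuousWithinAt ?_
        refine continuousAt_const.congr (f := fun _ ↦ v + f i x - f j x) ?_
        have h1 : ∀ᶠ p : M × F in 𝓝 (x, v), p.2 = v := by
          have : ∀ᶠ w in 𝓝 v, w = v := by rw [nhds_discrete]; exact eventually_pure.2 rfl
          have ht : Tendsto (Prod.snd : M × F → F) (𝓝 (x, v)) (𝓝 v) := continuous_snd.tendsto _
          exact ht.eventually this
        have ht : Tendsto (Prod.fst : M × F → M) (𝓝 (x, v)) (𝓝 x) := continuous_fst.tendsto _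
        have h2 : ∀ᶠ p : M × F in 𝓝 (x, v), f i p.1 - f j p.1 = f i x - f j x :=
          ht.eventually (hf i j x hx)
        filter_upwards [h1, h2] with p hp1 hp2
        rw [add_sub_assoc, add_sub_assoc, hp1, hp2]
      coordChange_comp := fun i j k x _ v ↦ by abel }
  have hcov : IsCoveringMap Z.proj := FiberBundle.isCoveringMap (F := F) (E := Z.Fiber)
  obtain ⟨x₀⟩ : Nonempty M := inferInstance
  -- Simple connectedness lifts the identity map to a section of the covering, that is, a coherent
  -- choice of primitive.
  obtain ⟨s, ⟨-, hs⟩, -⟩ := hcov.existsUnique_continuousMap_lifts (ContinuousMap.id M) x₀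
    (⟨x₀, (0 : F)⟩ : Z.TotalSpace) rfl
  have hs' (x : M) : (s x).1 = x := congrFun hs x
  let σ (x : M) : F := (s x).2
  refine ⟨fun x ↦ σ x + f (s x).1 x, fun i x hx ↦ ?_⟩
  have h1 : ContinuousAt (fun y ↦ (Z.localTriv i (s y)).2) x := by
    refine continuous_snd.continuousAt.comp (ContinuousAt.comp (g := Z.localTriv i) ?_
      s.continuous.continuousAt)
    refine (Z.localTriv i).continuousAt ?_
    rw [Z.mem_localTriv_source, hs']
    exact hx
  -- A continuous map to a discrete fibre is locally constant; in chart $i$ it is the glued function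
  -- minus $f_i$.
  have h2 : ∀ᶠ y in 𝓝 x, (Z.localTriv i (s y)).2 = (Z.localTriv i (s x)).2 := by
    have : ∀ᶠ w in 𝓝 (Z.localTriv i (s x)).2, w = (Z.localTriv i (s x)).2 := by
      rw [nhds_discrete]; exact eventually_pure.2 rfl
    exact h1.eventually this
  have h3 (y : M) : (Z.localTriv i (s y)).2 = σ y + f (s y).1 y - f i y := by
    have : (Z.localTriv i (s y)).2 = σ y + f (s y).1 (s y).1 - f i (s y).1 := rfl
    rw [this, hs']
  filter_upwards [h2] with y hy
  rw [h3, h3] at hy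
  exact hy

end Gluing

/-! ### Integrating a linear map that vanishes on brackets to a homomorphism -/

section Integration

set_option linter.unusedSectionVars false

variable {E : Type*} [NormedAddCommGroup E] [NormedSpace ℝ E] [FiniteDimensional ℝ E]
  {G : Type*} [TopologicalSpace G] [ChartedSpace E G] [Group G] [LieGroup 𝓘(ℝ, E) ∞ G]
  {F : Type*} [NormedAddCommGroup F] [NormedSpace ℝ F] [CompleteSpace F]

/-- A left-invariant closed form has local primitives. -/
theorem exists_local_primitive {ℓ : E →L[ℝ] F} (hℓ : ∀ u v : E, ℓ (lieOp G u v) = 0) (p : G) :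
    ∃ (U : Set G) (f : G → F), IsOpen U ∧ p ∈ U ∧ ∀ q ∈ U,
      MDifferentiableAt 𝓘(ℝ, E) 𝓘(ℝ, F) f q ∧ modelDeriv f q = ℓ ∘L mulLeftDeriv q⁻¹ q := by
  set e := extChartAt 𝓘(ℝ, E) p with he
  have hp : e p ∈ e.target := mem_extChartAt_target p
  have htopen : IsOpen e.target := isOpen_extChartAt_target (I := 𝓘(ℝ, E)) p
  obtain ⟨r, hr, hball⟩ := Metric.isOpen_iff.1 htopen _ hp
  have hω (x : E) (hx : x ∈ e.target) :
      HasFDerivAt (fun x ↦ ℓ ∘L coframe p x)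
        (ContinuousLinearMap.compL ℝ E E F ℓ ∘L fderiv ℝ (coframe p) x) x :=
    (ContinuousLinearMap.compL ℝ E E F ℓ).hasFDerivAt.comp x
      ((contDiffAt_coframe hx).differentiableAt (by simp)).hasFDerivAt
  have hdiff : DifferentiableOn ℝ (fun x ↦ ℓ ∘L coframe p x) (Metric.ball (e p) r) :=
    fun x hx ↦ (hω x (hball hx)).differentiableAt.differentiableWithinAt
  -- Poincaré lemma on a ball. The antisymmetrized derivative of the form is, up to sign, $\ell$ of
  -- a bracket, hence zero.
  obtain ⟨f, hf⟩ := (convex_ball (e p) r).exists_forall_hasFDerivAt_of_fderiv_symmetric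
    (𝕜 := ℝ) Metric.isOpen_ball hdiff (fun x hx u v ↦ by
      have hxt := hball hx
      have h1 (w : E) : w = frame p x (coframe p x w) :=
        (DFunLike.congr_fun (frame_comp_coframe hxt) w).symm
      have h2 := fderiv_frame_sub hxt (coframe p x u) (coframe p x v)
      rw [← h1, ← h1] at h2
      have h3 := congrArg (fun w ↦ ℓ (coframe p x w)) h2
      have h4 : coframe p x (frame p x (lieOp G (coframe p x u) (coframe p x v))) =
        lieOp G (coframe p x u) (coframe p x v) := DFunLike.congr_fun (coframe_comp_frame hxt) _
      simp only [h4, hℓ, map_sub] at h3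
      rw [(hω x hxt).fderiv]
      simp only [ContinuousLinearMap.comp_apply, ContinuousLinearMap.compL_apply,
        fderiv_coframe hxt, neg_apply, map_neg]
      rw [sub_eq_zero.1 h3])
  refine ⟨e.source ∩ e ⁻¹' Metric.ball (e p) r, f ∘ e, ?_, ⟨mem_extChartAt_source p,
    Metric.mem_ball_self hr⟩, fun q hq ↦ ?_⟩
  · exact (continuousOn_extChartAt p).isOpen_inter_preimage (isOpen_extChartAt_source p)
      Metric.isOpen_ball
  · have h1 : MDifferentiableAt 𝓘(ℝ, E) 𝓘(ℝ, E) e q :=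
      mdifferentiableAt_extChartAt (by rw [← extChartAt_source 𝓘(ℝ, E)]; exact hq.1)
    have h2 := hf (e q) hq.2
    refine ⟨h2.differentiableAt.mdifferentiableAt.comp q h1, ?_⟩
    have h3 := modelDeriv_comp h2.differentiableAt h1
    refine h3.trans ?_
    have h4 : e.symm (e q) = q := e.left_inv hq.1
    have h5 := chartSymmDeriv_comp_chartDeriv (p := p) (x := e q) (hball hq.2)
    rw [h2.fderiv, coframe, ← he]
    simp only [← he, h4] at h5 ⊢
    have h6 : (modelDeriv e q : E →L[ℝ] E) = chartDeriv p q := rfl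
    rw [h6, ContinuousLinearMap.comp_assoc, ContinuousLinearMap.comp_assoc, h5,
      ContinuousLinearMap.comp_id]

theorem modelDeriv_sub {M : Type*} [TopologicalSpace M] [ChartedSpace E M] {f g : M → F} {p : M}
    (hf : MDifferentiableAt 𝓘(ℝ, E) 𝓘(ℝ, F) f p) (hg : MDifferentiableAt 𝓘(ℝ, E) 𝓘(ℝ, F) g p) :
    modelDeriv (fun q ↦ f q - g q) p = (modelDeriv f p - modelDeriv g p : E →L[ℝ] F) :=
  (hf.hasMFDerivAt.sub hg.hasMFDerivAt).mfderiv

/-- On a simply connected group, a linear form on the Lie algebra vanishing on brackets is the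
differential of a function at every point, up to left translation. -/
theorem exists_primitive [SimplyConnectedSpace G] {ℓ : E →L[ℝ] F}
    (hℓ : ∀ u v : E, ℓ (lieOp G u v) = 0) :
    ∃ Φ : G → F, MDifferentiable 𝓘(ℝ, E) 𝓘(ℝ, F) Φ ∧
      ∀ q, modelDeriv Φ q = ℓ ∘L mulLeftDeriv q⁻¹ q := by
  have : IsManifold 𝓘(ℝ, E) 1 G := isManifold_one_of_lieGroup
  have : LocallyPathConnectedSpace G := ChartedSpace.locallyPathConnectedSpace E G
  choose U f hU hmem hf using exists_local_primitive (G := G) hℓ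
  obtain ⟨Φ, hΦ⟩ := exists_glue f U hU hmem fun i j x hx ↦ by
    refine eventually_eq_of_mfderiv_eq_zero (E := E) (E' := F) (f := fun y ↦ f i y - f j y) ?_
    filter_upwards [(hU i).mem_nhds hx.1, (hU j).mem_nhds hx.2] with y hi hj
    refine ⟨(hf i y hi).1.sub (hf j y hj).1, ?_⟩
    have h := modelDeriv_sub (hf i y hi).1 (hf j y hj).1
    rw [(hf i y hi).2, (hf j y hj).2, sub_self] at h
    exact h
  have h1 (q : G) : HasMFDerivAt 𝓘(ℝ, E) 𝓘(ℝ, F) Φ q (mfderiv 𝓘(ℝ, E) 𝓘(ℝ, F) (f q) q) := by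
    have h2 := ((hf q q (hmem q)).1.hasMFDerivAt).add (hasMFDerivAt_const (Φ q - f q q) q)
    have h3 : mfderiv 𝓘(ℝ, E) 𝓘(ℝ, F) (f q) q + 0 = mfderiv 𝓘(ℝ, E) 𝓘(ℝ, F) (f q) q := by
      ext v; exact add_zero _
    have h4 : HasMFDerivAt 𝓘(ℝ, E) 𝓘(ℝ, F) (fun y ↦ f q y + (Φ q - f q q)) q
        (mfderiv 𝓘(ℝ, E) 𝓘(ℝ, F) (f q) q) := h3 ▸ h2
    refine h4.congr_of_eventuallyEq ?_
    filter_upwards [hΦ q q (hmem q)] with y hy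
    rw [← hy]; abel
  exact ⟨Φ, fun q ↦ (h1 q).mdifferentiableAt, fun q ↦ (h1 q).mfderiv.trans (hf q q (hmem q)).2⟩

/-- A linear map from the Lie algebra of a simply connected group to a vector space that vanishes on
brackets integrates to a homomorphism. -/
theorem exists_hom [SimplyConnectedSpace G] {ℓ : E →L[ℝ] F}
    (hℓ : ∀ u v : E, ℓ (lieOp G u v) = 0) :
    ∃ Φ : G → F, ContMDiff 𝓘(ℝ, E) 𝓘(ℝ, F) ∞ Φ ∧ (∀ a b, Φ (a * b) = Φ a + Φ b) ∧
      modelDeriv Φ 1 = ℓ := by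
  have : IsManifold 𝓘(ℝ, E) 1 G := isManifold_one_of_lieGroup
  obtain ⟨Ψ, hΨ, hd⟩ := exists_primitive (G := G) hℓ
  have hsmooth : ContMDiff 𝓘(ℝ, E) 𝓘(ℝ, F) ∞ Ψ := by
    intro p
    set e := extChartAt 𝓘(ℝ, E) p with he
    have h1 (x : E) (hx : x ∈ e.target) :
        HasFDerivAt (fun x ↦ Ψ (e.symm x)) (ℓ ∘L coframe p x) x := by
      have hsymm : MDifferentiableAt 𝓘(ℝ, E) 𝓘(ℝ, E) e.symm x :=
        ((contMDiffOn_extChartAt_symm (I := 𝓘(ℝ, E)) (n := ∞) p).contMDiffAt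
          ((isOpen_extChartAt_target (I := 𝓘(ℝ, E)) p).mem_nhds hx)).mdifferentiableAt (by simp)
      have h2 := ((hΨ (e.symm x)).hasMFDerivAt.comp x hsymm.hasMFDerivAt).hasFDerivAt
      refine HasFDerivAt.congr_fderiv h2 ?_
      have h3 := congrArg (· ∘L chartSymmDeriv p x) (hd (e.symm x))
      exact h3
    -- The primitive is only known to be differentiable; it is smooth because its derivative in the
    -- chart is $\ell$ after the smooth coframe.
    have h4 : ContDiffOn ℝ ∞ (fun x ↦ Ψ (e.symm x)) e.target := by
      have ho : IsOpen e.target := isOpen_extChartAt_target (I := 𝓘(ℝ, E)) p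
      refine (contDiffOn_infty_iff_fderiv_of_isOpen ho).2
        ⟨fun x hx ↦ (h1 x hx).differentiableAt.differentiableWithinAt, ?_⟩
      refine ContDiffOn.congr (f := fun x ↦ ℓ ∘L coframe p x) (fun x hx ↦ ?_)
        fun x hx ↦ (h1 x hx).fderiv
      exact (contDiffAt_const.clm_comp (contDiffAt_coframe hx)).contDiffWithinAt
    have h5 : ContMDiffAt 𝓘(ℝ, E) 𝓘(ℝ, F) ∞ (fun x ↦ Ψ (e.symm x)) (e p) :=
      (h4.contDiffAt (extChartAt_target_mem_nhds p)).contMDiffAt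
    have h6 : ContMDiffAt 𝓘(ℝ, E) 𝓘(ℝ, F) ∞ ((fun x ↦ Ψ (e.symm x)) ∘ e) p :=
      h5.comp p contMDiffAt_extChartAt
    refine h6.congr_of_eventuallyEq ?_
    filter_upwards [extChartAt_source_mem_nhds (I := 𝓘(ℝ, E)) p] with q hq
    exact congrArg Ψ (e.left_inv hq).symm
  -- Left-invariance of the form makes $b\mapsto\Psi(ab)-\Psi(b)$ constant. Subtracting $\Psi(1)$
  -- then gives a homomorphism.
  have hmul (a b : G) : Ψ (a * b) - Ψ b = Ψ a - Ψ 1 := by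
    have hda (b : G) : MDifferentiableAt 𝓘(ℝ, E) 𝓘(ℝ, F) (fun b ↦ Ψ (a * b)) b :=
      (hΨ (a * b)).comp b (mdifferentiableAt_mul_left a b)
    have h1 := eq_of_mfderiv_eq_zero (E := E) (E' := F) (f := fun b ↦ Ψ (a * b) - Ψ b)
      (fun b ↦ (hda b).sub (hΨ b)) (fun b ↦ by
        have h2 : (modelDeriv (fun b ↦ Ψ (a * b)) b : E →L[ℝ] F) =
            modelDeriv Ψ (a * b) ∘L mulLeftDeriv a b :=
          mfderiv_comp b (hΨ (a * b)) (mdifferentiableAt_mul_left a b)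
        have h3 := modelDeriv_sub (hda b) (hΨ b)
        have h4 := mulLeftDeriv_comp (E := E) (a * b)⁻¹ a b
        rw [h2, hd, hd, ContinuousLinearMap.comp_assoc, h4,
          show (a * b)⁻¹ * a = b⁻¹ by group, sub_self] at h3
        exact h3) b 1
    simpa using h1
  refine ⟨fun x ↦ Ψ x - Ψ 1, hsmooth.sub contMDiff_const, fun a b ↦ ?_, ?_⟩
  · change Ψ (a * b) - Ψ 1 = (Ψ a - Ψ 1) + (Ψ b - Ψ 1)
    rw [← hmul a b]; abel
  · have h1 := modelDeriv_sub (hΨ 1) (mdifferentiableAt_const (c := Ψ 1))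
    have h2 : (modelDeriv (fun _ : G ↦ Ψ 1) 1 : E →L[ℝ] F) = 0 := mfderiv_const
    rw [h1, h2, hd, sub_zero, inv_one, mulLeftDeriv_one_left, ContinuousLinearMap.comp_id]

end Integration

/-! ### A left-invariant metric making the homomorphism a Riemannian submersion -/

section Metric

variable {E : Type*} [NormedAddCommGroup E] [NormedSpace ℝ E]
  {G : Type*} [TopologicalSpace G] [ChartedSpace E G] [Group G] [LieGroup 𝓘(ℝ, E) ∞ G]
  {H : Type*} [NormedAddCommGroup H] [InnerProductSpace ℝ H]

/-- The pullback of the inner product of `H` under a linear map. -/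
def pullbackInner (A : E →L[ℝ] H) : E →L[ℝ] E →L[ℝ] ℝ := (innerSL ℝ).bilinearComp A A

theorem pullbackInner_apply (A : E →L[ℝ] H) (v w : E) :
    pullbackInner A v w = inner ℝ (A v) (A w) := rfl

theorem contDiff_pullbackInner [FiniteDimensional ℝ E] :
    ContDiff ℝ ∞ (pullbackInner : (E →L[ℝ] H) → _) := by
  refine contDiff_clm_apply_iff.2 fun v ↦ contDiff_clm_apply_iff.2 fun w ↦ ?_
  simp only [pullbackInner_apply]
  exact (contDiff_id.clm_apply contDiff_const).inner ℝ (contDiff_id.clm_apply contDiff_const)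

theorem symmL_trivializationAt_eq {p q : G} (hq : q ∈ (extChartAt 𝓘(ℝ, E) p).source) (v : E) :
    ((trivializationAt E (TangentSpace 𝓘(ℝ, E) : G → Type _) p).symm q v : E) =
      chartSymmDeriv p (extChartAt 𝓘(ℝ, E) p q) v := by
  have : IsManifold 𝓘(ℝ, E) 1 G := isManifold_one_of_lieGroup
  rw [extChartAt_source] at hq
  have h := TangentBundle.symmL_trivializationAt (I := 𝓘(ℝ, E)) (x₀ := p) (x := q) hq
  rw [modelWithCornersSelf_coe, range_id, mfderivWithin_univ] at h
  have hq' : q ∈ (trivializationAt E (TangentSpace 𝓘(ℝ, E) : G → Type _) p).baseSet := by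
    rw [TangentBundle.trivializationAt_baseSet]; exact hq
  rw [← Trivialization.symmL_apply (R := ℝ) _ hq']
  exact DFunLike.congr_fun h v

/-- In the trivialization at $p$ the form is the pullback of the inner product under `J` after the
coframe, and the coframe is smooth. -/
theorem contMDiff_pullbackInner [FiniteDimensional ℝ E] (J : E →L[ℝ] H) :
    ContMDiff 𝓘(ℝ, E) (𝓘(ℝ, E).prod 𝓘(ℝ, E →L[ℝ] E →L[ℝ] ℝ)) ∞
      (fun p : G ↦ TotalSpace.mk' (E →L[ℝ] E →L[ℝ] ℝ)
        (E := fun b : G ↦ TangentSpace 𝓘(ℝ, E) b →L[ℝ] TangentSpace 𝓘(ℝ, E) b →L[ℝ] ℝ) p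
        (pullbackInner (E := E) (J ∘L mulLeftDeriv p⁻¹ p))) := by
  intro p
  have : IsManifold 𝓘(ℝ, E) 1 G := isManifold_one_of_lieGroup
  refine (contMDiffAt_hom_bundle _).2 ⟨contMDiffAt_id, ?_⟩
  have h1 : ContMDiffAt 𝓘(ℝ, E) 𝓘(ℝ, E →L[ℝ] E →L[ℝ] ℝ) ∞
      ((fun x : E ↦ pullbackInner (J ∘L coframe p x)) ∘ extChartAt 𝓘(ℝ, E) p) p := by
    refine ContMDiffAt.comp p (ContDiffAt.contMDiffAt ?_) contMDiffAt_extChartAt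
    exact contDiff_pullbackInner.contDiffAt.comp _
      (contDiffAt_const.clm_comp (contDiffAt_coframe (mem_extChartAt_target p)))
  refine h1.congr_of_eventuallyEq ?_
  filter_upwards [extChartAt_source_mem_nhds (I := 𝓘(ℝ, E)) p] with q hq
  ext v w
  have hq' : q ∈ (trivializationAt E (TangentSpace 𝓘(ℝ, E) : G → Type _) p).baseSet := by
    rw [TangentBundle.trivializationAt_baseSet, ← extChartAt_source 𝓘(ℝ, E)]; exact hq
  refine (inCoordinates_apply_eq₂ hq' hq' (mem_univ q)).trans ?_
  have hs (w : E) : mulLeftDeriv q⁻¹ q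
      (show E from (trivializationAt E (TangentSpace 𝓘(ℝ, E) : G → Type _) p).symm q w) =
      coframe p (extChartAt 𝓘(ℝ, E) p q) w := by
    have h1 : (extChartAt 𝓘(ℝ, E) p).symm (extChartAt 𝓘(ℝ, E) p q) = q :=
      (extChartAt 𝓘(ℝ, E) p).left_inv hq
    rw [coframe, h1]
    exact congrArg (mulLeftDeriv q⁻¹ q) (symmL_trivializationAt_eq hq w)
  simp only [Trivial.fiberBundle_trivializationAt', Trivial.linearMapAt_trivialization]
  exact congrArg₂ (fun x y ↦ inner ℝ (J x) (J y)) (hs v) (hs w)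

theorem pullbackInner_pos {J : E →L[ℝ] H} {K : H →L[ℝ] E} (hKJ : ∀ v, K (J v) = v) (p : G)
    {v : E} (hv : v ≠ 0) : 0 < pullbackInner (J ∘L mulLeftDeriv p⁻¹ p) v v := by
  refine real_inner_self_pos.2 fun h ↦ hv ?_
  have h1 : mulLeftDeriv p⁻¹ p v = 0 := by
    rw [← hKJ (mulLeftDeriv p⁻¹ p v)]; exact (congrArg K h).trans (map_zero K)
  have h2 := DFunLike.congr_fun (mulLeftDeriv_comp_inv (E := E) p) v
  rw [ContinuousLinearMap.comp_apply, h1, map_zero] at h2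
  exact h2.symm

/-- The left-invariant metric that at the identity is the pullback of the inner product of `H`
under a linear embedding. -/
def leftInvariantMetric [FiniteDimensional ℝ E] (J : E →L[ℝ] H) (K : H →L[ℝ] E)
    (hKJ : ∀ v, K (J v) = v) : Metric E G where
  inner p := pullbackInner (E := E) (J ∘L mulLeftDeriv p⁻¹ p)
  symm p v w := real_inner_comm _ _
  pos p v hv := pullbackInner_pos hKJ p hv
  isVonNBounded p := by
    -- The unit ball of the metric at `p` lies in the image of the unit ball of `H` under a
    -- continuous linear map, because `K` inverts `J` on its range.
    have h : Bornology.IsVonNBounded ℝ ((mulLeftDeriv p 1 ∘L K) '' Metric.ball (0 : H) 1) :=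
      (NormedSpace.isVonNBounded_ball ℝ H 1).image _
    refine Bornology.IsVonNBounded.subset (E := E) (fun v hv ↦ ?_) h
    refine ⟨J (mulLeftDeriv p⁻¹ p v), ?_, ?_⟩
    · have h1 : inner ℝ (J (mulLeftDeriv p⁻¹ p v)) (J (mulLeftDeriv p⁻¹ p v)) < 1 := hv
      rw [real_inner_self_eq_norm_sq] at h1
      rw [mem_ball_zero_iff]
      nlinarith [norm_nonneg (J (mulLeftDeriv p⁻¹ p v))]
    · rw [ContinuousLinearMap.comp_apply, hKJ]
      exact DFunLike.congr_fun (mulLeftDeriv_comp_inv (E := E) p) v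
  contMDiff := contMDiff_pullbackInner J

theorem isLeftInvariant_leftInvariantMetric [FiniteDimensional ℝ E] (J : E →L[ℝ] H)
    (K : H →L[ℝ] E) (hKJ : ∀ v, K (J v) = v) :
    IsLeftInvariant (leftInvariantMetric (G := G) J K hKJ) := by
  intro a b v w
  have h1 : mulLeftDeriv (a * b)⁻¹ (a * b) ∘L mulLeftDeriv a b = mulLeftDeriv (E := E) b⁻¹ b := by
    rw [mulLeftDeriv_comp, show (a * b)⁻¹ * a = b⁻¹ by group]
  have h2 (v : E) : mulLeftDeriv (a * b)⁻¹ (a * b) (mulLeftDeriv a b v) =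
    mulLeftDeriv b⁻¹ b v := DFunLike.congr_fun h1 v
  exact congrArg₂ (fun x y ↦ inner ℝ (J x) (J y)) (h2 v) (h2 w)

variable {F : Type*} [NormedAddCommGroup F] [InnerProductSpace ℝ F] [FiniteDimensional ℝ F]

/-- For a surjective smooth homomorphism to a Euclidean space there is a left-invariant metric that
makes it a Riemannian submersion. -/
theorem exists_isRiemannianSubmersion [FiniteDimensional ℝ E] {Φ : G → F}
    (hΦ : ContMDiff 𝓘(ℝ, E) 𝓘(ℝ, F) ∞ Φ) (hmul : ∀ a b, Φ (a * b) = Φ a + Φ b)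
    (hsurj : Function.Surjective Φ)
    (hd : Function.Surjective (modelDeriv Φ 1 : E →L[ℝ] F)) :
    ∃ g : Metric E G, IsLeftInvariant g ∧ IsRiemannianSubmersion g Φ := by
  have hmd : MDifferentiable 𝓘(ℝ, E) 𝓘(ℝ, F) Φ := hΦ.mdifferentiable (by simp)
  set L : E →L[ℝ] F := modelDeriv Φ 1 with hL
  obtain ⟨s, hs⟩ := (L : E →ₗ[ℝ] F).exists_rightInverse_of_surjective
    (LinearMap.range_eq_top.2 hd)
  let S : F →L[ℝ] E := s.toContinuousLinearMap
  have hS (y : F) : L (S y) = y := LinearMap.congr_fun hs y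
  -- `T` only supplies an inner product on `E`. The embedding `J` sends $v$ to $(Lv, v-SLv)$, so the
  -- range of `S` becomes the orthogonal complement of $\ker L$ and `L` is isometric on it.
  let T := toEuclidean (E := E)
  let C := WithLp.prodContinuousLinearEquiv 2 ℝ F (EuclideanSpace ℝ (Fin (Module.finrank ℝ E)))
  let J : E →L[ℝ] WithLp 2 (F × EuclideanSpace ℝ (Fin (Module.finrank ℝ E))) :=
    C.symm.toContinuousLinearMap ∘L
      L.prod (T.toContinuousLinearMap ∘L (ContinuousLinearMap.id ℝ E - S ∘L L))
  let K : WithLp 2 (F × EuclideanSpace ℝ (Fin (Module.finrank ℝ E))) →L[ℝ] E :=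
    (S ∘L ContinuousLinearMap.fst ℝ F _ + T.symm.toContinuousLinearMap ∘L ContinuousLinearMap.snd ℝ F _) ∘L
      C.toContinuousLinearMap
  have hKJ (v : E) : K (J v) = v := by simp [K, J]
  have hJ (v w : E) : inner ℝ (J v) (J w) =
      inner ℝ (L v) (L w) + inner ℝ (T (v - S (L v))) (T (w - S (L w))) := rfl
  have hdΦ (p : G) (v : E) : modelDeriv Φ p v = L (mulLeftDeriv p⁻¹ p v) := by
    rw [hL, ← modelDeriv_mulLeftDeriv hmd hmul p, ← ContinuousLinearMap.comp_apply (mulLeftDeriv p 1),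
      mulLeftDeriv_comp_inv, ContinuousLinearMap.id_apply]
  have hinv (p : G) (v : E) : mulLeftDeriv p⁻¹ p (mulLeftDeriv p 1 v) = v :=
    DFunLike.congr_fun (mulLeftDeriv_inv_comp (E := E) p) v
  have hsur (p : G) : Function.Surjective (modelDeriv Φ p : E →L[ℝ] F) := fun y ↦
    ⟨mulLeftDeriv p 1 (S y), (modelDeriv_mulLeftDeriv hmd hmul p (S y)).trans (hS y)⟩
  have hiso (p : G) (v w : E) (hv : ∀ k : E, modelDeriv Φ p k = 0 →
      inner ℝ (J (mulLeftDeriv p⁻¹ p v)) (J (mulLeftDeriv p⁻¹ p k)) = 0) :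
      inner ℝ (modelDeriv Φ p v) (modelDeriv Φ p w) =
        inner ℝ (J (mulLeftDeriv p⁻¹ p v)) (J (mulLeftDeriv p⁻¹ p w)) := by
    rw [hdΦ p v, hdΦ p w]
    set v' := mulLeftDeriv p⁻¹ p v
    -- The vector $v'-SLv'$ is vertical, and its inner product with the horizontal $v'$ is its own
    -- squared length.
    have h1 : v' - S (L v') = 0 := by
      have h2 := hv (mulLeftDeriv p 1 (v' - S (L v')))
        ((modelDeriv_mulLeftDeriv hmd hmul p _).trans (by rw [← hL, map_sub, hS, sub_self]))
      rw [hinv, hJ, map_sub L, hS, sub_self, inner_zero_right, zero_add, map_zero, sub_zero,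
        inner_self_eq_zero] at h2
      exact T.map_eq_zero_iff.1 h2
    rw [hJ, h1, map_zero, inner_zero_left, add_zero]
  exact ⟨leftInvariantMetric J K hKJ, isLeftInvariant_leftInvariantMetric J K hKJ, hΦ, hsurj,
    hsur, fun p v w hv _ ↦ hiso p v w hv⟩

end Metric

/-! ### Existence of natural epimorphisms, and isotropy in real terms -/

section Main

set_option linter.unusedSectionVars false

variable {E : Type*} [NormedAddCommGroup E] [NormedSpace ℝ E] [FiniteDimensional ℝ E]
  {G : Type*} [TopologicalSpace G] [ChartedSpace E G] [Group G] [LieGroup 𝓘(ℝ, E) ∞ G]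

/-- A smooth homomorphism to a vector space whose differential at the identity is surjective is
surjective. -/
theorem surjective_of_modelDeriv_one {F : Type*} [NormedAddCommGroup F] [NormedSpace ℝ F]
    [FiniteDimensional ℝ F] {Φ : G → F} (hΦ : ContMDiff 𝓘(ℝ, E) 𝓘(ℝ, F) ∞ Φ)
    (hmul : ∀ a b, Φ (a * b) = Φ a + Φ b)
    (hd : Function.Surjective (modelDeriv Φ 1 : E →L[ℝ] F)) : Function.Surjective Φ := by
  have : CompleteSpace E := FiniteDimensional.complete ℝ E
  have : CompleteSpace F := FiniteDimensional.complete ℝ F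
  have : IsManifold 𝓘(ℝ, E) 1 G := isManifold_one_of_lieGroup
  set e := extChartAt 𝓘(ℝ, E) (1 : G)
  have he : e 1 ∈ e.target := mem_extChartAt_target 1
  have he1 : e.symm (e 1) = 1 := extChartAt_to_inv 1
  have hone : Φ 1 = 0 := by simpa using hmul 1 1
  have h1 : ContMDiffAt 𝓘(ℝ, E) 𝓘(ℝ, F) ∞ (Φ ∘ e.symm) (e 1) :=
    hΦ.contMDiffAt.comp (e 1) ((contMDiffOn_extChartAt_symm (I := 𝓘(ℝ, E)) (n := ∞) 1).contMDiffAt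
      ((isOpen_extChartAt_target (I := 𝓘(ℝ, E)) (1 : G)).mem_nhds he))
  have h2 : HasStrictFDerivAt (Φ ∘ e.symm) (fderiv ℝ (Φ ∘ e.symm) (e 1)) (e 1) :=
    h1.contDiffAt.hasStrictFDerivAt (by simp)
  have hsymm : MDifferentiableAt 𝓘(ℝ, E) 𝓘(ℝ, E) e.symm (e 1) :=
    ((contMDiffOn_extChartAt_symm (I := 𝓘(ℝ, E)) (n := ∞) (1 : G)).contMDiffAt
      ((isOpen_extChartAt_target (I := 𝓘(ℝ, E)) (1 : G)).mem_nhds he)).mdifferentiableAt (by simp)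
  have h3 : (fderiv ℝ (Φ ∘ e.symm) (e 1) : E →L[ℝ] F) =
      modelDeriv Φ (e.symm (e 1)) ∘L chartSymmDeriv (1 : G) (e 1) := by
    rw [← mfderiv_eq_fderiv]
    exact mfderiv_comp (e 1) (hΦ.mdifferentiable (by simp) _) hsymm
  have h4 : Function.Surjective (fderiv ℝ (Φ ∘ e.symm) (e 1)) := by
    rw [h3, he1]
    refine hd.comp fun v ↦ ⟨chartDeriv (1 : G) (e.symm (e 1)) v, ?_⟩
    exact DFunLike.congr_fun (chartSymmDeriv_comp_chartDeriv he) v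
  have h5 := h2.map_nhds_eq_of_surj (LinearMap.range_eq_top.2 h4)
  have h6 : range Φ ∈ 𝓝 (0 : F) := by
    have : (Φ ∘ e.symm) (e 1) = 0 := by rw [Function.comp_apply, he1, hone]
    rw [this] at h5
    rw [← h5]
    exact Filter.mem_map.2 (univ_mem' fun x ↦ mem_range_self _)
  intro y
  -- The range contains a neighbourhood of $0$, so some $y/(k+1)$ is a value $\Phi(x)$, and then
  -- $\Phi(x^{k+1})=y$.
  have h7 : Tendsto (fun k : ℕ ↦ ((k : ℝ) + 1)⁻¹ • y) atTop (𝓝 0) := by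
    have := (tendsto_one_div_add_atTop_nhds_zero_nat (𝕜 := ℝ)).smul_const y
    simpa using this
  obtain ⟨k, x, hx⟩ := (h7.eventually h6).exists
  have h8 (m : ℕ) : Φ (x ^ m) = (m : ℝ) • Φ x := by
    induction m with
    | zero => simpa using hone
    | succ m ih => rw [pow_succ, hmul, ih]; push_cast; module
  refine ⟨x ^ (k + 1), ?_⟩
  rw [h8, hx, smul_smul]
  push_cast
  rw [mul_inv_cancel₀ (by positivity), one_smul]

variable {n : ℕ}

theorem IsNaturalEpimorphism.surjective_modelDeriv
    {ψ : (GroupLieAlgebra 𝓘(ℝ, E) G ⧸ derivedAlgebra E G) ≃ₗ[ℝ] EuclideanSpace ℝ (Fin n)}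
    {Φ : G → EuclideanSpace ℝ (Fin n)} (h : IsNaturalEpimorphism ψ Φ) :
    Function.Surjective (modelDeriv Φ 1 : E →L[ℝ] EuclideanSpace ℝ (Fin n)) := fun y ↦ by
  obtain ⟨v, hv⟩ := (ψ.surjective.comp (derivedAlgebra E G).mkQ_surjective) y
  exact ⟨v, (h.mfderiv_one v).trans hv⟩

theorem exists_isNaturalEpimorphism [SimplyConnectedSpace G]
    (ψ : (GroupLieAlgebra 𝓘(ℝ, E) G ⧸ derivedAlgebra E G) ≃ₗ[ℝ] EuclideanSpace ℝ (Fin n)) :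
    ∃ Φ : G → EuclideanSpace ℝ (Fin n), IsNaturalEpimorphism ψ Φ := by
  let ℓ₀ : E →ₗ[ℝ] EuclideanSpace ℝ (Fin n) := ψ.toLinearMap ∘ₗ (derivedAlgebra E G).mkQ
  let ℓ : E →L[ℝ] EuclideanSpace ℝ (Fin n) := ℓ₀.toContinuousLinearMap
  have hℓ (u v : E) : ℓ (lieOp G u v) = 0 := by
    let u' : GroupLieAlgebra 𝓘(ℝ, E) G := u
    let v' : GroupLieAlgebra 𝓘(ℝ, E) G := v
    let w : GroupLieAlgebra 𝓘(ℝ, E) G := ⁅u', v'⁆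
    have hw : w ∈ derivedAlgebra E G := Submodule.subset_span ⟨u', v', rfl⟩
    have h : (derivedAlgebra E G).mkQ w = 0 := (Submodule.Quotient.mk_eq_zero _).2 hw
    exact (congrArg ψ h).trans (map_zero ψ)
  obtain ⟨Φ, hΦ, hmul, hd⟩ := exists_hom (G := G) hℓ
  refine ⟨Φ, hΦ, hmul, surjective_of_modelDeriv_one hΦ hmul ?_, fun X ↦ DFunLike.congr_fun hd X⟩
  rw [hd]
  exact ψ.surjective.comp (derivedAlgebra E G).mkQ_surjective

theorem component_eq_complexComponent (Φ : G → EuclideanSpace ℝ (Fin n)) (v : Fin n → ℂ) :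
    component Φ v = complexComponent Φ (WithLp.toLp 2 fun i ↦ (v i).re)
      (WithLp.toLp 2 fun i ↦ (v i).im) := by
  funext x
  apply Complex.ext
  · simp [component, complexComponent, dotProduct, PiLp.inner_apply]
  · simp [component, complexComponent, dotProduct, PiLp.inner_apply]

/-- The real and imaginary parts of the bilinear form; for $w=v$ they say that the real and
imaginary parts of $v$ have equal length and are orthogonal. -/
theorem inner_of_dotProduct_eq_zero {v w : Fin n → ℂ} (h : v ⬝ᵥ w = 0) :
    (inner ℝ (WithLp.toLp 2 fun i ↦ (v i).re) (WithLp.toLp 2 fun i ↦ (w i).re) : ℝ) -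
      inner ℝ (WithLp.toLp 2 fun i ↦ (v i).im) (WithLp.toLp 2 fun i ↦ (w i).im) = 0 ∧
    (inner ℝ (WithLp.toLp 2 fun i ↦ (v i).re) (WithLp.toLp 2 fun i ↦ (w i).im) : ℝ) +
      inner ℝ (WithLp.toLp 2 fun i ↦ (v i).im) (WithLp.toLp 2 fun i ↦ (w i).re) = 0 := by
  have h1 := congrArg Complex.re h
  have h2 := congrArg Complex.im h
  simp only [dotProduct, Complex.re_sum, Complex.im_sum, Complex.mul_re, Complex.mul_im,
    Complex.zero_re, Complex.zero_im] at h1 h2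
  simp only [PiLp.inner_apply, ← Finset.sum_sub_distrib, ← Finset.sum_add_distrib]
  refine ⟨?_, ?_⟩
  · rw [← h1]
    exact Finset.sum_congr rfl fun i _ ↦ by simp; ring
  · rw [← h2]
    exact Finset.sum_congr rfl fun i _ ↦ by simp; ring

end Main

end HarmonicMorphisms
end

theorem mainTheorem2 {E : Type*} [NormedAddCommGroup E] [NormedSpace ℝ E] [FiniteDimensional ℝ E]
    {G : Type*} [TopologicalSpace G] [T2Space G] [ChartedSpace E G] [Group G]
    [LieGroup 𝓘(ℝ, E) ∞ G] [SimplyConnectedSpace G] [Group.IsNilpotent G]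
    (hG : ¬ ∀ a b : G, a * b = b * a)
    (n : ℕ)
    (hn : n = Module.finrank ℝ
      (GroupLieAlgebra 𝓘(ℝ, E) G ⧸ HarmonicMorphisms.derivedAlgebra E G)) :
    2 ≤ n ∧
    (∀ ψ : (GroupLieAlgebra 𝓘(ℝ, E) G ⧸ HarmonicMorphisms.derivedAlgebra E G) ≃ₗ[ℝ]
        EuclideanSpace ℝ (Fin n),
      (∃ Φ : G → EuclideanSpace ℝ (Fin n), HarmonicMorphisms.IsNaturalEpimorphism ψ Φ) ∧
      ∀ Φ : G → EuclideanSpace ℝ (Fin n), HarmonicMorphisms.IsNaturalEpimorphism ψ Φ →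
        (∃ g : HarmonicMorphisms.Metric E G, HarmonicMorphisms.IsLeftInvariant g ∧
          HarmonicMorphisms.IsRiemannianSubmersion g Φ) ∧
        ∀ g : HarmonicMorphisms.Metric E G, HarmonicMorphisms.IsLeftInvariant g →
          HarmonicMorphisms.IsRiemannianSubmersion g Φ →
          ∀ V : Submodule ℂ (Fin n → ℂ), Maximal HarmonicMorphisms.IsIsotropic V →
            HarmonicMorphisms.IsOrthogonalHarmonicFamily g
              {φ | ∃ v ∈ V, φ = HarmonicMorphisms.component Φ v} ∧
            ∀ v ∈ V, HarmonicMorphisms.IsHarmonicMorphism g (HarmonicMorphisms.component Φ v)) := by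
  have : CompleteSpace E := FiniteDimensional.complete ℝ E
  have htr := HarmonicMorphisms.trace_lieAd (E := E) (G := G)
  refine ⟨hn ▸ HarmonicMorphisms.two_le_finrank_quotient_derivedAlgebra hG, fun ψ ↦
    ⟨HarmonicMorphisms.exists_isNaturalEpimorphism ψ, fun Φ hΦ ↦
      ⟨HarmonicMorphisms.exists_isRiemannianSubmersion hΦ.contMDiff hΦ.map_mul hΦ.surjective
        hΦ.surjective_modelDeriv, fun g hg hs V hV ↦ ?_⟩⟩⟩
  have hiso : HarmonicMorphisms.IsIsotropic V := hV.prop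
  refine ⟨⟨?_, ?_, ?_⟩, fun v hv ↦ ?_⟩
  · rintro _ ⟨v, -, rfl⟩
    rw [HarmonicMorphisms.component_eq_complexComponent]
    exact HarmonicMorphisms.contMDiff_complexComponent hΦ.contMDiff _ _
  · rintro _ ⟨v, -, rfl⟩ p
    rw [HarmonicMorphisms.component_eq_complexComponent]
    exact HarmonicMorphisms.tau_complexComponent htr hg hs hΦ.map_mul _ _ p
  · rintro _ ⟨v, hv, rfl⟩ _ ⟨w, hw, rfl⟩ p
    obtain ⟨h1, h2⟩ := HarmonicMorphisms.inner_of_dotProduct_eq_zero (hiso v hv w hw)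
    rw [HarmonicMorphisms.component_eq_complexComponent,
      HarmonicMorphisms.component_eq_complexComponent,
      HarmonicMorphisms.kappa_complexComponent hg hs hΦ.map_mul, h1, h2]
    simp
  · obtain ⟨h1, h2⟩ := HarmonicMorphisms.inner_of_dotProduct_eq_zero (hiso v hv v hv)
    rw [HarmonicMorphisms.component_eq_complexComponent]
    refine HarmonicMorphisms.isHarmonicMorphism_complexComponent htr hg hs hΦ.map_mul ?_
      (sub_eq_zero.1 h1)
    -- After the swap `h2` states that twice the inner product of the real and imaginary parts of
    -- $v$ is zero.
    rw [real_inner_comm (WithLp.toLp 2 fun i ↦ (v i).re)] at h2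
    linarith
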